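/- Let $V$ be a finite-dimensional real inner product space, whose dual is identified with $V$ by $\langle\cdot,\cdot\rangle$, let $\Delta\subset V$ be a finite reduced (crystallographic) root system with fundamental system $\{\alpha_1,\dots,\alpha_r\}$, simple coroots $\alpha_i^\vee\in V$ and fundamental weights $\lambda_j$, $\langle\alpha_i^\vee,\lambda_j\rangle=\delta_{ij}$. For $J\subset\{1,\dots,r\}$ put $Q_J^\vee=\bigoplus_{j\in J}\mathbb Z\alpha_j^\vee$, $P_J=\bigoplus_{j\in J}\mathbb Z\lambda_j$, $V_J=\bigoplus_{j\in J}\mathbb R\alpha_j$, and $Q^\vee=Q^\vee_{\{1,\dots,r\}}$. An element $\gamma=\eta_\gamma+c_\gamma\delta$ of $V\oplus\mathbb R\delta$ acts on $V$ by $\gamma(v)=\langle\eta_\gamma,v\rangle+c_\gamma$. For $\Re s>1$ and $x,c\in\mathbb R$ let $$L_s(x,c)=-\frac{\Gamma(s+1)}{(2\pi i)^s}\sum_{n\in\mathbb Z,\ n+c\ne0}\frac{e^{2\pi i(n+c)x}}{(n+c)^s},$$ and for $s=1$, $c\in\mathbb Z$ let $L_1(x,c)$ be given by the same series summed symmetrically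 (so that $L_1(x,c)=x-\tfrac12$ for $0<x<1$). Let $I\subset\{1,\dots,r\}$, $I^c$ its complement, and let $D$ be a finite subset of $Q^\vee\oplus\mathbb Z\delta$ with $\eta_\gamma\neq0$ for all $\gamma\in D$, containing $B=\{\gamma_i=\eta_i+c_i\delta\}_{i\in I^c}$ where $\{\eta_i\}_{i\in I^c}$ is a basis of $Q^\vee_{I^c}$. Let $\{\mu_i\}_{i\in I^c}\subset P_{I^c}$ be the dual basis, $\nu=\sum_{i\in I^c}c_i\mu_i$, $N=|D\setminus B|$. Let $k_\gamma$ ($\gamma\in D$) be integers with $k_\gamma\ge2$ for $\gamma\in B$ and $k_\gamma\ge1$ otherwise, and $|\mathbf k|=\sum_{\gamma\in D}k_\gamma$. Fix $\mathbf y\in V_{I^c}$ and put $y_i=\langle\mathbf y,\mu_i\rangle$. For $z=(z_\gamma)\in\mathbb C^{D\setminus B}$ define $$\Phi(z)=(-1)^{|D|}e^{-2\pi i\langle\mathbf y,\nu\rangle}\Bigl(\prod_{\gamma\in D}\frac{(2\pi i)^{k_\gamma}}{\Gamma(k_\gamma+1)}\Bigr)\int_{[0,1]^{D\setminus B}}\exp\Bigl(-2\pi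 i\sum_{\gamma\in D\setminus B}z_\gamma x_\gamma\Bigr)\prod_{\gamma\in D\setminus B}L_{k_\gamma}(x_\gamma,c_\gamma)\prod_{i\in I^c}L_{k_{\gamma_i}}\Bigl(y_i-\sum_{\gamma\in D\setminus B}x_\gamma\langle\eta_\gamma,\mu_i\rangle,c_i\Bigr)\,dx,$$ and for $\lambda\in P_I$ let $f^\sharp(\lambda)$ be given by this formula with $z_\gamma$ replaced by $\gamma(\lambda-\nu)$. Let $\mathbb Q[\mathbf y]\subset\mathbb R$ be the ring generated over $\mathbb Q$ by the $y_i$, $A=\sum_{i\in I^c}\mathbb Zy_i+\mathbb Z$, and $\mathbb QA=\sum_{i\in I^c}\mathbb Qy_i+\mathbb Q$. Then $\Phi$ is an entire function, $f^\sharp(\lambda)=\Phi\bigl((\gamma(\lambda-\nu))_\gamma\bigr)$ for all $\lambda\in P_I$, and there are finite families $(f^{(k)}_\eta)_\eta$, $(g^{(k)}_\eta)_\eta$ of functions on $\mathbb C^{D\setminus B}$, for $0\le k\le|\mathbf k|$, such that each $f^{(k)}_\eta(z)=p\,e^{\pi i\sum_\gamma a_\gamma z_\gamma}$ with $p\in\mathbb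 Q[\mathbf y]$ and $a_\gamma\in\mathbb QA$, each $g^{(k)}_\eta(z)$ is a product of $k+N$ nonzero linear forms $\sum_\gamma a_\gamma z_\gamma$ with $a_\gamma\in A$, and $$\Phi(z)=e^{-2\pi i\langle\mathbf y,\nu\rangle}\sum_{k=0}^{|\mathbf k|}(\pi i)^{|\mathbf k|-(k+N)}\sum_\eta\frac{f^{(k)}_\eta(z)}{g^{(k)}_\eta(z)}$$ for all $z$ at which no $g^{(k)}_\eta$ vanishes. In particular the formula holds for $f^\sharp(\lambda)$, with $z_\gamma=\gamma(\lambda-\nu)$, when no denominator vanishes there, and in general $f^\sharp(\lambda)$ is the value of the analytic continuation of the right-hand side. -/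

import Mathlib

open scoped RealInnerProductSpace

noncomputable section

namespace FuncRel

/-! ### Lattices attached to a root system -/

section RootData

variable {ι M N : Type*} [AddCommGroup M] [Module ℝ M] [AddCommGroup N] [Module ℝ N]
  {P : RootPairing ι ℝ M N}

/-- The lattice `Q_J^∨ = ⨁_{j ∈ J} ℤ α_j^∨`, for a set `J` of simple indices
(`J = univ` gives the coroot lattice `Q^∨`). -/
def corootLattice (b : P.Base) (J : Finset b.support) : Submodule ℤ N :=
  Submodule.span ℤ ((fun j : b.support => P.coroot j) '' (J : Set b.support))

/-- The real span `V_J` of the simple roots `α_j`, `j ∈ J`. -/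
def rootSubspace (b : P.Base) (J : Finset b.support) : Submodule ℝ M :=
  Submodule.span ℝ ((fun j : b.support => P.root j) '' (J : Set b.support))

/-- The affine coroot lattice `Q^∨ ⊕ ℤ δ` inside `N ⊕ ℝ δ = N × ℝ`. -/
def affineCorootLattice (b : P.Base) : Submodule ℤ (N × ℝ) :=
  (corootLattice b Finset.univ).prod (Submodule.span ℤ {(1 : ℝ)})

variable [P.IsRootSystem]

/-- The fundamental weight `λ_j`: the vector with `⟨λ_j, α_i^∨⟩ = δ_{ij}` for all simple coroots
(see `fundamentalWeight_coroot`). -/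
def fundamentalWeight (b : P.Base) (j : b.support) : M :=
  P.toLinearMap.toPerfPair.symm (b.toCoweightBasis.coord j)

theorem fundamentalWeight_coroot [DecidableEq ι] (b : P.Base) (i j : b.support) :
    P.toLinearMap (fundamentalWeight b j) (P.coroot i) = if i = j then 1 else 0 := by
  have h : P.toLinearMap (fundamentalWeight b j) = b.toCoweightBasis.coord j := by
    exact P.toLinearMap.toPerfPair.apply_symm_apply _
  rw [h, ← b.toCoweightBasis_apply i]
  simp [Finsupp.single_apply]

/-- The lattice `P_J = ⨁_{j ∈ J} ℤ λ_j`. -/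
def weightLattice (b : P.Base) (J : Finset b.support) : Submodule ℤ M :=
  Submodule.span ℤ (fundamentalWeight b '' (J : Set b.support))

end RootData

/-! ### The function `f^♯` -/

/-- `L_s(x, c) = -Γ(s+1)/(2πi)^s · ∑_{n ∈ ℤ, n + c ≠ 0} e^{2πi(n+c)x} / (n+c)^s`.

The sum over `ℤ` is the limit of the symmetric partial sums `∑_{-K ≤ n ≤ K}`. For `Re s > 1` the
series converges absolutely, so this is its ordinary sum; for `s = 1` and integral `c` it is only
conditionally convergent, and the symmetric sum gives `B_1(x) = x - 1/2` for `0 < x < 1`. -/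
def lerchL (s : ℂ) (x c : ℝ) : ℂ :=
  -(Complex.Gamma (s + 1) / (2 * Real.pi * Complex.I) ^ s) *
    ∑'[SummationFilter.symmetricIcc ℤ] n : ℤ,
      if (n : ℝ) + c = 0 then 0
      else Complex.exp (2 * Real.pi * Complex.I * (((n : ℝ) + c : ℝ) : ℂ) * x) /
        (((n : ℝ) + c : ℝ) : ℂ) ^ s

section FSharp

variable {V J : Type*} [NormedAddCommGroup V] [InnerProductSpace ℝ V] [Fintype J]

/-- The affine functional `v ↦ ⟨η, v⟩ + c` attached to `γ = η + c δ ∈ V ⊕ ℝ δ`. -/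
def affineEval (γ : V × ℝ) (v : V) : ℝ := ⟪γ.1, v⟫ + γ.2

open Classical in
/-- The set `D ∖ B`, where `B = {γ_j}` is given as a family. -/
def nonBasis (D : Finset (V × ℝ)) (B : J → V × ℝ) : Finset (V × ℝ) :=
  D.filter fun γ => γ ∉ Set.range B

/-- `ν = ∑_j c_j μ_j`, where `γ_j = η_j + c_j δ`. -/
def nuVec (B : J → V × ℝ) (μ : J → V) : V := ∑ j, (B j).2 • μ j

/-- The function `f^♯` attached to the set `D` of affine functionals, the subfamily
`B = (γ_j)`, the dual family `μ = (μ_j)`, the exponents `s_γ` and `y`. -/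
def fSharp (D : Finset (V × ℝ)) (B : J → V × ℝ) (μ : J → V) (s : V × ℝ → ℂ) (y lam : V) : ℂ :=
  (-1) ^ D.card *
    Complex.exp (-(2 * Real.pi * Complex.I * (⟪y, nuVec B μ⟫ : ℝ))) *
    (∏ γ ∈ D, (2 * Real.pi * Complex.I) ^ (s γ) / Complex.Gamma (s γ + 1)) *
    ∫ x in Set.Icc (0 : nonBasis D B → ℝ) 1,
      Complex.exp (-(2 * Real.pi * Complex.I *
        ((∑ γ : nonBasis D B, affineEval γ.1 (lam - nuVec B μ) * x γ : ℝ) : ℂ))) *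
      (∏ γ : nonBasis D B, lerchL (s γ.1) (x γ) γ.1.2) *
      ∏ j, lerchL (s (B j)) (⟪y, μ j⟫ - ∑ γ : nonBasis D B, x γ * ⟪γ.1.1, μ j⟫) (B j).2

/-- The function of `z ∈ ℂ^{D ∖ B}` given by the formula for `f^♯`, with the values `γ(λ - ν)`
replaced by independent complex variables `z_γ`. -/
def fSharpExt (D : Finset (V × ℝ)) (B : J → V × ℝ) (μ : J → V) (s : V × ℝ → ℂ) (y : V)
    (z : nonBasis D B → ℂ) : ℂ :=
  (-1) ^ D.card *
    Complex.exp (-(2 * Real.pi * Complex.I * (⟪y, nuVec B μ⟫ : ℝ))) *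
    (∏ γ ∈ D, (2 * Real.pi * Complex.I) ^ (s γ) / Complex.Gamma (s γ + 1)) *
    ∫ x in Set.Icc (0 : nonBasis D B → ℝ) 1,
      Complex.exp (-(2 * Real.pi * Complex.I * ∑ γ : nonBasis D B, z γ * (x γ : ℂ))) *
      (∏ γ : nonBasis D B, lerchL (s γ.1) (x γ) γ.1.2) *
      ∏ j, lerchL (s (B j)) (⟪y, μ j⟫ - ∑ γ : nonBasis D B, x γ * ⟪γ.1.1, μ j⟫) (B j).2

end FSharp

/-! ### Numerators and denominators

For fixed real numbers `u = (y_j)`. The variables `z = (z_γ)`, `γ ∈ Γ`, stand for the affine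
functionals in `D̄ = {γ ∘ τ(-ν)}`. -/

section Terms

variable {J Γ : Type*} [Fintype Γ]

/-- The ring `ℚ[y]` generated over `ℚ` by the `y_j`. -/
def polyRing (u : J → ℝ) : Subalgebra ℚ ℝ := Algebra.adjoin ℚ (Set.range u)

/-- The group `A(y) = ∑_j ℤ y_j + ℤ`. -/
def coeffGroup (u : J → ℝ) : AddSubgroup ℝ := AddSubgroup.closure (insert 1 (Set.range u))

/-- The rational span `ℚ A(y) = ∑_j ℚ y_j + ℚ`. -/
def coeffSpace (u : J → ℝ) : Submodule ℚ ℝ := Submodule.span ℚ (insert 1 (Set.range u))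

/-- The linear form `z ↦ ∑_γ a_γ z_γ` on `ℂ^Γ` with real coefficients. -/
def linForm (a : Γ → ℝ) (z : Γ → ℂ) : ℂ := ∑ γ, (a γ : ℂ) * z γ

/-- The elements of `ℚ[y] · exp(πi · ℚ A(y) D̄)`. -/
def IsNumerator (u : J → ℝ) (F : (Γ → ℂ) → ℂ) : Prop :=
  ∃ p ∈ polyRing u, ∃ a : Γ → ℝ, (∀ γ, a γ ∈ coeffSpace u) ∧
    ∀ z, F z = (p : ℂ) * Complex.exp (Real.pi * Complex.I * linForm a z)

/-- The elements of `(A(y) D̄)^n`: products of `n` linear forms with coefficients in `A(y)`.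
The forms are required to be nonzero. -/
def IsDenominator (u : J → ℝ) (n : ℕ) (G : (Γ → ℂ) → ℂ) : Prop :=
  ∃ a : Fin n → Γ → ℝ, (∀ q, a q ≠ 0 ∧ ∀ γ, a q γ ∈ coeffGroup u) ∧
    ∀ z, G z = ∏ q, linForm (a q) z

end Terms

end FuncRel

end

noncomputable section

namespace FuncRel

/-! ### The functions `L_k(x, c)` for integral `k` and `c` -/

section Lerch

open Filter Topology Finset SummationFilter

/-! Up to elementary factors, Φ is a Laplace transform over the unit cube, evaluated at -2πi z. For
integral k and c one has L_k(x, c) = B_k({x}), everywhere if k ≥ 2 and on the open unit interval if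
k = 1. The function being transformed is therefore, almost everywhere, a product of periodic
Bernoulli polynomials in the affine functions x_γ and y_i - ∑ x_γ⟨η_γ, μ_i⟩. These have rational
linear part, because the pairings are integers, and constant term in ℚA. On the cube each {f} equals
f - n on finitely many slabs n ≤ f < n + 1, so the product is a sum of polynomials of degree at most
|k| multiplied by indicators of polytopes.

Two mechanisms produce the formula. Integrating an exponential over a polytope one variable at a
time divides by one nonzero linear form in z per variable, with exponents evaluated at affine
endpoints; this gives N factors in the denominator (`integral_stepFun_mul_exp_mem`). Multiplying the
integrand by x_γ differentiates the transform in z_γ, and the quotient rule adds at most one factor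
(`expFrac_mem_derivSubmodule`, `coord_mul_mem_laplaceDegreeLE`). Degree at most |k| then gives
denominators with κ + N factors, 0 ≤ κ ≤ |k|.

These identities are first obtained off finitely many hyperplanes, tracked by `genericFilter`. To
make the final identity hold wherever no denominator vanishes, terms with numerator zero are added
whose denominators vanish on the exceptional hyperplanes (`exists_numerators_denominators`).
Entirety is differentiation under the integral sign over a compact cube. -/

theorem norm_sum_range_pow_le {w : ℂ} (hw : ‖w‖ = 1) (hw1 : w ≠ 1) (n : ℕ) :
    ‖∑ i ∈ range n, w ^ (i + 1)‖ ≤ 2 / ‖w - 1‖ := by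
  have h : ∑ i ∈ range n, w ^ (i + 1) = w * ((w ^ n - 1) / (w - 1)) := by
    rw [← geom_sum_eq hw1, mul_sum]
    exact sum_congr rfl fun i _ => pow_succ' w i
  rw [h, norm_mul, hw, one_mul, norm_div]
  gcongr
  calc ‖w ^ n - 1‖ ≤ ‖w ^ n‖ + ‖(1 : ℂ)‖ := norm_sub_le _ _
    _ = 2 := by rw [norm_pow, hw]; norm_num

/-- Places 1 - w in the slit plane, where the logarithm is continuous, as the Abel limit requires.
-/
theorem one_sub_re_pos {w : ℂ} (hw : ‖w‖ = 1) (hw1 : w ≠ 1) : 0 < (1 - w).re := by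
  have h1 : w.re ≤ 1 := hw ▸ Complex.re_le_norm w
  rcases h1.lt_or_eq with h | h
  · simpa using h
  · exfalso
    have h2 := Complex.sq_norm w
    rw [hw, Complex.normSq_apply, h] at h2
    apply hw1
    apply Complex.ext
    · simpa using h
    · simp only [Complex.one_im]; nlinarith

/-- The power series of `-log (1 - w)` on the unit circle. -/
theorem tendsto_sum_pow_div_of_norm_eq_one {w : ℂ} (hw : ‖w‖ = 1) (hw1 : w ≠ 1) :
    Tendsto (fun n : ℕ => ∑ i ∈ range n, w ^ i / (i : ℂ)) atTop (𝓝 (-Complex.log (1 - w))) := by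
  -- Dirichlet's test: bounded geometric sums against the decreasing weights 1/(i+1).
  have hc : CauchySeq fun n : ℕ => ∑ i ∈ range n, ((1 : ℝ) / ((i : ℝ) + 1)) • w ^ (i + 1) := by
    refine Antitone.cauchySeq_series_mul_of_tendsto_zero_of_bounded ?_
      tendsto_one_div_add_atTop_nhds_zero_nat (norm_sum_range_pow_le hw hw1)
    intro a b hab
    simp only
    gcongr
  obtain ⟨l, hl⟩ := cauchySeq_tendsto_of_complete hc
  have hl' : Tendsto (fun n : ℕ => ∑ i ∈ range n, w ^ i / (i : ℂ)) atTop (𝓝 l) := by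
    rw [← tendsto_add_atTop_iff_nat 1]
    refine hl.congr fun n => ?_
    rw [sum_range_succ']
    simp only [Nat.cast_zero, div_zero, add_zero]
    refine sum_congr rfl fun i _ => ?_
    rw [Complex.real_smul]
    push_cast
    ring
  -- Abel's limit theorem identifies the sum: the radial limit of the power series is compared with
  -- that of -log(1 - z w).
  have hA := Complex.tendsto_tsum_powerSeries_nhdsWithin_lt hl'
  have hB : Tendsto (fun z : ℂ => -Complex.log (1 - z * w)) ((𝓝[<] (1 : ℝ)).map Complex.ofReal)
      (𝓝 (-Complex.log (1 - w))) := by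
    have hs : 1 - (1 : ℂ) * w ∈ Complex.slitPlane := by
      left; simpa using one_sub_re_pos hw hw1
    have hcont : ContinuousAt (fun z : ℂ => -Complex.log (1 - z * w)) 1 :=
      ((by fun_prop : ContinuousAt (fun z : ℂ => 1 - z * w) 1).clog hs).neg
    have h := hcont.tendsto
    simp only [one_mul] at h
    refine h.comp ?_ |>.mono_left le_rfl
    rw [tendsto_map'_iff]
    exact (Complex.continuous_ofReal.tendsto' 1 1 (by simp)).mono_left nhdsWithin_le_nhds
  have hE : (fun z : ℂ => ∑' n : ℕ, w ^ n / (n : ℂ) * z ^ n) =ᶠ[(𝓝[<] (1 : ℝ)).map Complex.ofReal]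
      fun z => -Complex.log (1 - z * w) := by
    rw [EventuallyEq, eventually_map]
    filter_upwards [Ioo_mem_nhdsLT (show (0 : ℝ) < 1 by norm_num)] with x hx
    have hx1 : ‖(x : ℂ) * w‖ < 1 := by
      rw [norm_mul, hw, mul_one, Complex.norm_real, Real.norm_of_nonneg hx.1.le]; exact hx.2
    rw [← (Complex.hasSum_taylorSeries_neg_log hx1).tsum_eq]
    refine tsum_congr fun n => ?_
    rw [mul_pow]; ring
  have := tendsto_nhds_unique (hA.congr' hE) hB
  rwa [this] at hl'

/-- Holds because 1 - e^{2πix} = 2 sin(πx) e^{πi(x - 1/2)}, with positive modulus and argument in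
(-π/2, π/2). -/
theorem log_one_sub_exp {x : ℝ} (h0 : 0 < x) (h1 : x < 1) :
    (Complex.log (1 - Complex.exp (2 * Real.pi * Complex.I * x))).im = Real.pi * (x - 1 / 2) := by
  have hs : 0 < 2 * Real.sin (Real.pi * x) := by
    have := Real.sin_pos_of_pos_of_lt_pi (x := Real.pi * x) (by positivity)
      (by nlinarith [Real.pi_pos])
    linarith
  have : 1 - Complex.exp (2 * Real.pi * Complex.I * x) =
      ((2 * Real.sin (Real.pi * x) : ℝ) : ℂ) *
        Complex.exp (((Real.pi * (x - 1 / 2) : ℝ) : ℂ) * Complex.I) := by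
    have e1 : Complex.exp (2 * Real.pi * Complex.I * x) =
        Complex.exp ((Real.pi * x : ℝ) * Complex.I) ^ 2 := by
      rw [← Complex.exp_nat_mul]; push_cast; ring_nf
    have e2 : Complex.exp (((Real.pi * (x - 1 / 2) : ℝ) : ℂ) * Complex.I) =
        Complex.exp ((Real.pi * x : ℝ) * Complex.I) * (-Complex.I) := by
      rw [← Complex.exp_neg_pi_div_two_mul_I, ← Complex.exp_add]; push_cast; ring_nf
    rw [e1, e2, Complex.exp_mul_I, ← Complex.ofReal_cos, ← Complex.ofReal_sin]
    have h := Real.sin_sq_add_cos_sq (Real.pi * x)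
    have h' : ((Real.sin (Real.pi * x) : ℝ) : ℂ) ^ 2 + ((Real.cos (Real.pi * x) : ℝ) : ℂ) ^ 2 = 1 := by
      exact_mod_cast h
    push_cast at h' ⊢
    linear_combination (-1 : ℂ) * h' + (Complex.sin (Real.pi * x)) ^ 2 * Complex.I_sq
  rw [this, Complex.log_ofReal_mul hs (Complex.exp_ne_zero _), Complex.log_exp]
  · simp
  · simp; nlinarith [Real.pi_pos]
  · simp; nlinarith [Real.pi_pos]

/-- The sawtooth series, summed symmetrically. -/
theorem hasSum_symmetricIcc_exp_div {x : ℝ} (h0 : 0 < x) (h1 : x < 1) :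
    HasSum (fun n : ℤ => Complex.exp (2 * Real.pi * Complex.I * (n : ℂ) * x) / (n : ℂ))
      (-(2 * Real.pi * Complex.I) * (x - 1 / 2)) (symmetricIcc ℤ) := by
  rw [hasSum_symmetricIcc_iff]
  set w := Complex.exp (2 * Real.pi * Complex.I * x) with hwdef
  have hw : ‖w‖ = 1 := by
    rw [hwdef, show 2 * Real.pi * Complex.I * x = ((2 * Real.pi * x : ℝ) : ℂ) * Complex.I by
      push_cast; ring, Complex.norm_exp_ofReal_mul_I]
  have hw1 : w ≠ 1 := by
    intro h
    have := log_one_sub_exp h0 h1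
    rw [← hwdef, h] at this
    -- With the convention log 0 = 0, w = 1 would force x = 1/2, where in fact w = -1.
    simp only [sub_self, Complex.log_zero, Complex.zero_im] at this
    have h3 : (w).re = Real.cos (2 * Real.pi * x) := by
      rw [hwdef, show 2 * Real.pi * Complex.I * x = ((2 * Real.pi * x : ℝ) : ℂ) * Complex.I by
        push_cast; ring, Complex.exp_ofReal_mul_I_re]
    have h4 : x = 1 / 2 := by
      have := (mul_eq_zero.1 this.symm).resolve_left Real.pi_ne_zero
      linarith
    rw [h, h4, show 2 * Real.pi * (1 / 2) = Real.pi by ring, Real.cos_pi] at h3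
    norm_num at h3
  have hT := tendsto_sum_pow_div_of_norm_eq_one hw hw1
  -- The term at -n is minus the conjugate of the term at n, so the symmetric sum up to N is S -
  -- conj S, with S the partial sum over `range (N + 1)`; the term at 0 is 0 by division by zero.
  have hT' := (Complex.continuous_conj.tendsto _).comp hT
  have hsum := (hT.sub hT').comp (tendsto_add_atTop_nat 1)
  have hlim : -Complex.log (1 - w) - (starRingEnd ℂ) (-Complex.log (1 - w)) =
      -(2 * Real.pi * Complex.I) * (x - 1 / 2) := by
    rw [Complex.sub_conj, Complex.neg_im, log_one_sub_exp h0 h1]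
    push_cast; ring
  rw [hlim] at hsum
  refine hsum.congr fun N => ?_
  simp only [Function.comp_apply, map_sum]
  induction N with
  | zero => simp
  | succ N ih =>
    rw [sum_range_succ, sum_range_succ (fun i => (starRingEnd ℂ) _)]
    have hI : Icc (-((N + 1 : ℕ) : ℤ)) ((N + 1 : ℕ) : ℤ) =
        insert (-((N + 1 : ℕ) : ℤ)) (insert ((N + 1 : ℕ) : ℤ) (Icc (-(N : ℤ)) N)) := by
      ext a; simp only [mem_insert, mem_Icc]; push_cast; omega
    rw [hI, sum_insert, sum_insert, ← ih]
    · have e1 : w ^ (N + 1) =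
          Complex.exp (2 * Real.pi * Complex.I * (((N + 1 : ℕ) : ℤ) : ℂ) * x) := by
        rw [hwdef, ← Complex.exp_nat_mul]; push_cast; ring_nf
      have e2 : (starRingEnd ℂ) (w ^ (N + 1)) =
          Complex.exp (2 * Real.pi * Complex.I * ((-((N + 1 : ℕ) : ℤ) : ℤ) : ℂ) * x) := by
        rw [e1, ← Complex.exp_conj]
        congr 1
        simp only [map_mul, Complex.conj_I, Complex.conj_ofReal, map_ofNat]
        push_cast
        simp only [map_add, map_natCast, map_one]
        ring
      rw [map_div₀, e2, e1, map_natCast]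
      push_cast
      rw [div_neg]
      ring
    · simp only [mem_Icc]; push_cast; omega
    · simp only [mem_insert, mem_Icc]; push_cast; omega

/-- Symmetric sums over `ℤ` of null sequences are invariant under translation. -/
theorem _root_.HasSum.symmetricIcc_add_int {f : ℤ → ℂ} {a : ℂ} (hf : HasSum f a (symmetricIcc ℤ))
    (h0 : Tendsto f cofinite (𝓝 0)) (c : ℤ) :
    HasSum (fun n => f (n + c)) a (symmetricIcc ℤ) := by
  have hc (c : ℤ) : Tendsto (fun n => f (n + c)) cofinite (𝓝 0) :=
    h0.comp (add_left_injective c).tendsto_cofinite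
  have hb (c : ℤ) {s : ℕ → ℤ} (hs : Function.Injective s) :
      Tendsto (fun N => f (s N + c)) atTop (𝓝 0) :=
    Nat.cofinite_eq_atTop ▸ (hc c).comp hs.tendsto_cofinite
  -- Moving the window by one step changes the sum by two boundary terms, which tend to 0.
  have hstep (N : ℕ) (c : ℤ) : ∑ n ∈ Icc (-(N : ℤ)) N, f (n + (c + 1)) =
      ∑ n ∈ Icc (-(N : ℤ)) N, f (n + c) + (f (N + (c + 1)) - f (-N + c)) := by
    have e1 : ∑ n ∈ Icc (-(N : ℤ)) N, f (n + (c + 1)) =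
        ∑ n ∈ Icc (-(N : ℤ) + 1) (N + 1), f (n + c) := by
      rw [← map_add_right_Icc, sum_map]
      refine sum_congr rfl fun n _ => ?_
      simp only [addRightEmbedding_apply]; congr 1; ring
    have e2 : insert (-(N : ℤ)) (Icc (-(N : ℤ) + 1) (N + 1)) =
        insert ((N : ℤ) + 1) (Icc (-(N : ℤ)) N) := by
      ext a; simp only [mem_insert, mem_Icc]; omega
    have e3 := congrArg (fun s => ∑ n ∈ s, f (n + c)) e2
    rw [sum_insert (by simp), sum_insert (by simp)] at e3
    rw [e1, show (N : ℤ) + (c + 1) = N + 1 + c by ring]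
    linear_combination e3
  have hz (c : ℤ) : Tendsto (fun N : ℕ => f (N + (c + 1)) - f (-N + c)) atTop (𝓝 0) := by
    simpa using (hb (c + 1) (s := fun N => (N : ℤ)) Nat.cast_injective).sub
      (hb c (s := fun N => -(N : ℤ)) (neg_injective.comp Nat.cast_injective))
  rw [hasSum_symmetricIcc_iff] at hf ⊢
  induction c with
  | zero => simpa using hf
  | succ c ih => simpa [hstep] using ih.add (hz c)
  | pred c ih =>
    have := ih.sub (hz (-(c : ℤ) - 1))
    rw [sub_zero] at this
    refine this.congr fun N => ?_
    have := hstep N (-(c : ℤ) - 1)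
    rw [sub_add_cancel] at this
    rw [this, sub_add_cancel]
    ring

/-- For exponent 1 there is no absolute convergence to give the decay of the terms, so it is read
off from their modulus 1/|n|. -/
theorem tendsto_exp_div_cofinite (x : ℝ) :
    Tendsto (fun n : ℤ => Complex.exp (2 * Real.pi * Complex.I * (n : ℂ) * x) / (n : ℂ))
      cofinite (𝓝 0) := by
  rw [tendsto_zero_iff_norm_tendsto_zero]
  have : Tendsto (fun n : ℤ => ‖(n : ℝ)‖⁻¹) cofinite (𝓝 0) := by
    exact tendsto_inv_atTop_zero.comp (tendsto_norm_cocompact_atTop.comp Int.tendsto_coe_cofinite)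
  refine this.congr fun n => ?_
  rw [norm_div, show 2 * Real.pi * Complex.I * (n : ℂ) * x =
    ((2 * Real.pi * n * x : ℝ) : ℂ) * Complex.I by push_cast; ring,
    Complex.norm_exp_ofReal_mul_I, one_div, Complex.norm_intCast, Real.norm_eq_abs]

/-- An integral c only translates the summation index, which the symmetric sum tolerates. The
omitted term n + c = 0 costs nothing, since division by 0 ^ k with k ≠ 0 gives 0. -/
theorem lerchL_eq_of_hasSum {k : ℕ} (hk : k ≠ 0) {x a : ℝ}
    (h : HasSum (fun n : ℤ => Complex.exp (2 * Real.pi * Complex.I * (n : ℂ) * x) / (n : ℂ) ^ k)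
      (-(2 * Real.pi * Complex.I) ^ k / k.factorial * a) (symmetricIcc ℤ))
    (h0 : Tendsto (fun n : ℤ => Complex.exp (2 * Real.pi * Complex.I * (n : ℂ) * x) / (n : ℂ) ^ k)
      cofinite (𝓝 0)) (c : ℤ) : lerchL k x c = a := by
  have h2 := (h.symmetricIcc_add_int h0 c).tsum_eq
  have hpi : (2 * Real.pi * Complex.I : ℂ) ^ k ≠ 0 :=
    pow_ne_zero _ Complex.two_pi_I_ne_zero
  have hfac : (k.factorial : ℂ) ≠ 0 := by exact_mod_cast k.factorial_ne_zero
  rw [lerchL, Complex.Gamma_nat_eq_factorial, Complex.cpow_natCast]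
  have h3 : (fun n : ℤ => if (n : ℝ) + (c : ℝ) = 0 then (0 : ℂ)
      else Complex.exp (2 * Real.pi * Complex.I * (((n : ℝ) + c : ℝ) : ℂ) * x) /
        (((n : ℝ) + c : ℝ) : ℂ) ^ (k : ℂ)) =
      fun n : ℤ => Complex.exp (2 * Real.pi * Complex.I * ((n + c : ℤ) : ℂ) * x) /
        ((n + c : ℤ) : ℂ) ^ k := by
    funext n
    split_ifs with hn
    · have : n + c = 0 := by exact_mod_cast hn
      rw [this]; simp [hk]
    · rw [Complex.cpow_natCast]; push_cast; rfl
  rw [h3, h2]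
  field_simp

/-- For `k ≥ 2` and integral `c`, `L_k(x, c) = B_k({x})`. -/
theorem lerchL_eq_bernoulliFun_fract {k : ℕ} (hk : 2 ≤ k) (x : ℝ) (c : ℤ) :
    lerchL k x c = bernoulliFun k (Int.fract x) := by
  have h := hasSum_one_div_pow_mul_fourier_mul_bernoulliFun hk (x := Int.fract x)
    ⟨Int.fract_nonneg x, (Int.fract_lt_one x).le⟩
  have h3 : (fun n : ℤ => 1 / (n : ℂ) ^ k * fourier n ((Int.fract x : ℝ) : UnitAddCircle)) =
      fun n : ℤ => Complex.exp (2 * Real.pi * Complex.I * (n : ℂ) * x) / (n : ℂ) ^ k := by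
    funext n
    rw [fourier_coe_apply]
    have : Complex.exp (2 * Real.pi * Complex.I * (n : ℂ) * (Int.fract x : ℝ) / ((1 : ℝ) : ℂ)) =
      Complex.exp (2 * Real.pi * Complex.I * (n : ℂ) * x) := by
      rw [Complex.exp_eq_exp_iff_exists_int]
      refine ⟨-(n * ⌊x⌋), ?_⟩
      rw [← Int.self_sub_floor]
      push_cast; ring
    rw [this]; ring
  rw [h3] at h
  exact lerchL_eq_of_hasSum (by omega) (h.mono_left LeAtTop.le_atTop) h.summable.tendsto_cofinite_zero c

/-- For integral `c` and `0 < x < 1`, `L_1(x, c) = B_1(x)`. -/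
theorem lerchL_one_eq {x : ℝ} (h0 : 0 < x) (h1 : x < 1) (c : ℤ) :
    lerchL (1 : ℕ) x c = bernoulliFun 1 x := by
  refine lerchL_eq_of_hasSum one_ne_zero ?_ ?_ c
  · simp only [pow_one, Nat.factorial_one, Nat.cast_one, div_one, bernoulliFun_one]
    push_cast
    exact hasSum_symmetricIcc_exp_div h0 h1
  · simpa using tendsto_exp_div_cofinite x

end Lerch

/-! ### Exponentials divided by products of linear forms -/

section ExpFrac

open Filter Topology Finset

variable {J Γ : Type*} [Fintype Γ]

/-- A nonzero linear form with coefficients in `A(y)`. -/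
def IsForm (u : J → ℝ) (w : Γ → ℝ) : Prop := w ≠ 0 ∧ ∀ γ, w γ ∈ coeffGroup u

/-- The function `exp (∑ a_γ z_γ) / ∏_q (∑ w_{q,γ} z_γ)`. -/
def expFrac (a : Γ → ℝ) {m : ℕ} (w : Fin m → Γ → ℝ) (z : Γ → ℂ) : ℂ :=
  Complex.exp (linForm a z) / ∏ q, linForm (w q) z

/-- The `ℚ[y]`-span of the functions `expFrac a w` with `m` forms in the denominator. -/
def expFracSpan (u : J → ℝ) (Γ : Type*) [Fintype Γ] (m : ℕ) :
    Submodule (polyRing u) ((Γ → ℂ) → ℂ) :=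
  Submodule.span (polyRing u) {f | ∃ (a : Γ → ℝ) (w : Fin m → Γ → ℝ),
    (∀ γ, a γ ∈ coeffSpace u) ∧ (∀ q, IsForm u (w q)) ∧ f = expFrac a w}

/-- The filter of sets containing the complement of finitely many hyperplanes over `A(y)`. -/
def genericFilter (u : J → ℝ) (Γ : Type*) [Fintype Γ] : Filter (Γ → ℂ) :=
  Filter.generate {S | ∃ w, IsForm u w ∧ S = {z | linForm w z ≠ 0}}

variable {u : J → ℝ}

theorem coeffGroup_le_polyRing {x : ℝ} (hx : x ∈ coeffGroup u) : x ∈ polyRing u := by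
  have : coeffGroup u ≤ (polyRing u).toSubmodule.toAddSubgroup := by
    rw [coeffGroup, AddSubgroup.closure_le]
    rintro y (rfl | hy)
    · exact (polyRing u).one_mem
    · exact Algebra.subset_adjoin hy
  exact this hx

theorem coeffSpace_le_polyRing {x : ℝ} (hx : x ∈ coeffSpace u) : x ∈ polyRing u := by
  have : coeffSpace u ≤ (polyRing u).toSubmodule := by
    rw [coeffSpace, Submodule.span_le]
    rintro y (rfl | hy)
    · exact (polyRing u).one_mem
    · exact Algebra.subset_adjoin hy
  exact this hx

theorem ratCast_mem_coeffSpace (q : ℚ) : (q : ℝ) ∈ coeffSpace u := by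
  have := (coeffSpace u).smul_mem q (Submodule.subset_span (Set.mem_insert 1 _))
  rwa [Rat.smul_one_eq_cast] at this

theorem ratCast_mem_polyRing (q : ℚ) : (q : ℝ) ∈ polyRing u :=
  coeffSpace_le_polyRing (ratCast_mem_coeffSpace q)

omit [Fintype Γ] in
theorem polyRing_smul_apply (p : polyRing u) (f : (Γ → ℂ) → ℂ) (z : Γ → ℂ) :
    (p • f) z = ((p : ℝ) : ℂ) * f z := by
  rw [Pi.smul_apply, Subalgebra.smul_def, Complex.real_smul]

theorem linForm_add_smul_single [DecidableEq Γ] (a : Γ → ℝ) (z : Γ → ℂ) (γ : Γ) (t : ℂ) :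
    linForm a (z + t • Pi.single γ 1) = linForm a z + t * a γ := by
  simp only [linForm, Pi.add_apply, Pi.smul_apply, smul_eq_mul, mul_add, sum_add_distrib]
  congr 1
  rw [sum_eq_single γ]
  · simp [mul_comm]
  · intro b _ hb; simp [hb]
  · simp

theorem continuous_linForm (a : Γ → ℝ) : Continuous (linForm a) := by
  unfold linForm; fun_prop

theorem eventually_linForm_ne {w : Γ → ℝ} (hw : IsForm u w) :
    ∀ᶠ z in genericFilter u Γ, linForm w z ≠ 0 :=
  Filter.GenerateSets.basic ⟨w, hw, rfl⟩

/-- Turns a generic statement into an explicit finite set of exceptional hyperplanes, which can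
later be written into denominators. -/
theorem exists_forms_of_eventually {p : (Γ → ℂ) → Prop} (h : ∀ᶠ z in genericFilter u Γ, p z) :
    ∃ W : Finset (Γ → ℝ), (∀ w ∈ W, IsForm u w) ∧ ∀ z, (∀ w ∈ W, linForm w z ≠ 0) → p z := by
  classical
  change GenerateSets _ {z | p z} at h
  suffices ∀ s, GenerateSets {S | ∃ w : Γ → ℝ, IsForm u w ∧ S = {z | linForm w z ≠ 0}} s →
      ∃ W : Finset (Γ → ℝ), (∀ w ∈ W, IsForm u w) ∧
        ∀ z, (∀ w ∈ W, linForm w z ≠ 0) → z ∈ s from this _ h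
  intro s hs
  induction hs with
  | basic hs =>
    obtain ⟨w, hw, rfl⟩ := hs
    exact ⟨{w}, by simpa using hw, fun z hz => by simpa using hz⟩
  | univ => exact ⟨∅, by simp, by simp⟩
  | superset _ hst ih =>
    obtain ⟨W, hW, h⟩ := ih
    exact ⟨W, hW, fun z hz => hst (h z hz)⟩
  | inter _ _ ih1 ih2 =>
    obtain ⟨W1, hW1, h1⟩ := ih1
    obtain ⟨W2, hW2, h2⟩ := ih2
    refine ⟨W1 ∪ W2, ?_, fun z hz => ⟨h1 z fun w hw => hz w (mem_union_left _ hw),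
      h2 z fun w hw => hz w (mem_union_right _ hw)⟩⟩
    intro w hw
    rcases mem_union.1 hw with h | h
    exacts [hW1 w h, hW2 w h]

/-- The complement of finitely many hyperplanes is open, so generic identities may be
differentiated. -/
theorem eventually_eventually_nhds_generic {p : (Γ → ℂ) → Prop}
    (h : ∀ᶠ z in genericFilter u Γ, p z) :
    ∀ᶠ z in genericFilter u Γ, ∀ᶠ z' in 𝓝 z, p z' := by
  obtain ⟨W, hW, h⟩ := exists_forms_of_eventually h
  have : ∀ᶠ z in genericFilter u Γ, ∀ w ∈ W, linForm w z ≠ 0 :=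
    (eventually_all_finset W).2 fun w hw => eventually_linForm_ne (hW w hw)
  filter_upwards [this] with z hz
  have : ∀ᶠ z' in 𝓝 z, ∀ w ∈ W, linForm w z' ≠ 0 :=
    (eventually_all_finset W).2 fun w hw =>
      (continuous_linForm w).continuousAt.eventually_ne (hz w hw)
  exact this.mono fun z' hz' => h z' hz'

theorem expFrac_mem {a : Γ → ℝ} {m : ℕ} {w : Fin m → Γ → ℝ} (ha : ∀ γ, a γ ∈ coeffSpace u)
    (hw : ∀ q, IsForm u (w q)) : expFrac a w ∈ expFracSpan u Γ m :=
  Submodule.subset_span ⟨a, w, ha, hw, rfl⟩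

theorem expFrac_cons (a : Γ → ℝ) {m : ℕ} (w₀ : Γ → ℝ) (w : Fin m → Γ → ℝ) (z : Γ → ℂ) :
    expFrac a (Fin.cons w₀ w : Fin (m + 1) → Γ → ℝ) z = expFrac a w z / linForm w₀ z := by
  simp only [expFrac, Fin.prod_univ_succ, Fin.cons_zero, Fin.cons_succ]
  rw [div_div, mul_comm]

/-- Division by a linear form, as a linear map. -/
def divForm (u : J → ℝ) (w : Γ → ℝ) : ((Γ → ℂ) → ℂ) →ₗ[polyRing u] ((Γ → ℂ) → ℂ) where
  toFun f z := f z / linForm w z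
  map_add' f g := by funext z; simp [add_div]
  map_smul' p f := by
    funext z
    simp only [polyRing_smul_apply, RingHom.id_apply, mul_div_assoc]

theorem map_divForm_expFracSpan_le {w : Γ → ℝ} (hw : IsForm u w) (m : ℕ) :
    (expFracSpan u Γ m).map (divForm u w) ≤ expFracSpan u Γ (m + 1) := by
  rw [expFracSpan, Submodule.map_span_le]
  rintro _ ⟨a, w', ha, hw', rfl⟩
  have : divForm u w (expFrac a w') = expFrac a (Fin.cons w w' : Fin (m + 1) → Γ → ℝ) := by
    funext z; rw [expFrac_cons]; rfl
  rw [this]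
  refine expFrac_mem ha fun q => ?_
  refine Fin.cases ?_ (fun i => ?_) q
  · simpa using hw
  · simpa using hw' i

/-- The functions whose partial derivative in the direction `γ` agrees generically with an element
of `S`. -/
def derivSubmodule [DecidableEq Γ] (S : Submodule (polyRing u) ((Γ → ℂ) → ℂ)) (γ : Γ) :
    Submodule (polyRing u) ((Γ → ℂ) → ℂ) where
  carrier := {f | ∃ g ∈ S, ∀ᶠ z in genericFilter u Γ, HasLineDerivAt ℂ f (g z) z (Pi.single γ 1)}
  zero_mem' := ⟨0, S.zero_mem, Eventually.of_forall fun z => by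
    simpa [HasLineDerivAt] using hasDerivAt_const (0 : ℂ) (0 : ℂ)⟩
  add_mem' := by
    rintro f₁ f₂ ⟨g₁, h₁, H₁⟩ ⟨g₂, h₂, H₂⟩
    refine ⟨g₁ + g₂, S.add_mem h₁ h₂, ?_⟩
    filter_upwards [H₁, H₂] with z hz₁ hz₂
    exact HasDerivAt.add hz₁ hz₂
  smul_mem' := by
    rintro p f ⟨g, h, H⟩
    refine ⟨p • g, S.smul_mem p h, ?_⟩
    filter_upwards [H] with z hz
    have := HasDerivAt.const_mul ((p : ℝ) : ℂ) hz
    simp only [HasLineDerivAt, polyRing_smul_apply]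
    exact this

theorem derivSubmodule_mono [DecidableEq Γ] {S T : Submodule (polyRing u) ((Γ → ℂ) → ℂ)}
    (h : S ≤ T) (γ : Γ) : derivSubmodule S γ ≤ derivSubmodule T γ :=
  fun _ ⟨g, hg, H⟩ => ⟨g, h hg, H⟩

/-- Induction on the number of factors by the quotient rule ∂(F/ℓ) = ∂F/ℓ - w_γ F/ℓ², with w_γ the
coefficient of z_γ in ℓ. The scalars that appear, coefficients of the exponent and of the forms, lie
in ℚ[y]. -/
theorem expFrac_mem_derivSubmodule [DecidableEq Γ] (γ : Γ) {a : Γ → ℝ}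
    (ha : ∀ γ, a γ ∈ coeffSpace u) {m : ℕ} (w : Fin m → Γ → ℝ) (hw : ∀ q, IsForm u (w q)) :
    expFrac a w ∈ derivSubmodule (expFracSpan u Γ m ⊔ expFracSpan u Γ (m + 1)) γ := by
  have hlin (b : Γ → ℝ) (z : Γ → ℂ) : HasDerivAt (fun t : ℂ => linForm b (z + t • Pi.single γ 1))
      (b γ : ℂ) 0 := by
    simp only [linForm_add_smul_single]
    simpa using ((hasDerivAt_id (0 : ℂ)).mul_const (b γ : ℂ)).const_add (linForm b z)
  induction m with
  | zero =>
    refine ⟨(⟨a γ, coeffSpace_le_polyRing (ha γ)⟩ : polyRing u) • expFrac a w,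
      Submodule.mem_sup_left (Submodule.smul_mem _ _ (expFrac_mem ha hw)),
      Eventually.of_forall fun z => ?_⟩
    have := (hlin a z).cexp
    simp only [HasLineDerivAt, polyRing_smul_apply]
    simpa [expFrac, mul_comm] using this
  | succ m ih =>
    set w' : Fin m → Γ → ℝ := fun q => w q.succ
    have hw' : ∀ q, IsForm u (w' q) := fun q => hw q.succ
    have hww : expFrac a w = fun z => expFrac a w' z / linForm (w 0) z := by
      funext z
      rw [← expFrac_cons]
      congr 1
      exact (Fin.cons_self_tail w).symm
    obtain ⟨g, hg, H⟩ := ih w' hw'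
    have hd : divForm u (w 0) g ∈ expFracSpan u Γ (m + 1) ⊔ expFracSpan u Γ (m + 1 + 1) := by
      have := Submodule.mem_map_of_mem (f := divForm u (w 0)) hg
      rw [Submodule.map_sup] at this
      exact sup_le_sup (map_divForm_expFracSpan_le (hw 0) _)
        (map_divForm_expFracSpan_le (hw 0) _) this
    -- This is the term F/ℓ²: `expFrac a w` is already F/ℓ with ℓ the form of `w 0`.
    have hf : divForm u (w 0) (expFrac a w) ∈ expFracSpan u Γ (m + 1 + 1) :=
      map_divForm_expFracSpan_le (hw 0) _ (Submodule.mem_map_of_mem (expFrac_mem ha hw))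
    refine ⟨divForm u (w 0) g -
      (⟨w 0 γ, coeffGroup_le_polyRing ((hw 0).2 γ)⟩ : polyRing u) • divForm u (w 0) (expFrac a w),
      Submodule.sub_mem _ hd (Submodule.mem_sup_right (Submodule.smul_mem _ _ hf)), ?_⟩
    filter_upwards [H, eventually_linForm_ne (hw 0)] with z hz hz0
    have h := HasDerivAt.div hz (hlin (w 0) z) (by simpa using hz0)
    rw [hww]
    simp only [HasLineDerivAt]
    refine h.congr_deriv ?_
    simp only [Pi.sub_apply, polyRing_smul_apply, divForm, LinearMap.coe_mk, AddHom.coe_mk,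
      zero_smul, add_zero]
    field_simp

theorem expFracSpan_le_derivSubmodule [DecidableEq Γ] (γ : Γ) (m : ℕ) :
    expFracSpan u Γ m ≤ derivSubmodule (expFracSpan u Γ m ⊔ expFracSpan u Γ (m + 1)) γ := by
  rw [expFracSpan, Submodule.span_le]
  rintro _ ⟨a, w, ha, hw, rfl⟩
  exact expFrac_mem_derivSubmodule γ ha w hw

/-- The sum of the spaces `expFracSpan u Γ (κ + N)` for `κ ≤ d`. -/
def expFracSpanLE (u : J → ℝ) (Γ : Type*) [Fintype Γ] (N d : ℕ) :
    Submodule (polyRing u) ((Γ → ℂ) → ℂ) :=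
  ⨆ κ ∈ range (d + 1), expFracSpan u Γ (κ + N)

theorem expFracSpan_le_expFracSpanLE {κ d : ℕ} (h : κ ≤ d) (N : ℕ) :
    expFracSpan u Γ (κ + N) ≤ expFracSpanLE u Γ N d :=
  le_iSup₂_of_le (f := fun κ (_ : κ ∈ range (d + 1)) => expFracSpan u Γ (κ + N)) κ
    (mem_range.2 (Nat.lt_succ_of_le h)) le_rfl

theorem expFracSpanLE_mono {d d' : ℕ} (h : d ≤ d') (N : ℕ) :
    expFracSpanLE u Γ N d ≤ expFracSpanLE u Γ N d' :=
  iSup₂_le fun _ hκ =>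
    expFracSpan_le_expFracSpanLE ((Nat.lt_succ_iff.1 (mem_range.1 hκ)).trans h) N

theorem expFracSpanLE_le_derivSubmodule [DecidableEq Γ] (γ : Γ) (N d : ℕ) :
    expFracSpanLE u Γ N d ≤ derivSubmodule (expFracSpanLE u Γ N (d + 1)) γ := by
  refine iSup₂_le fun κ hκ => (expFracSpan_le_derivSubmodule γ _).trans
    (derivSubmodule_mono (sup_le ?_ ?_) γ)
  · exact expFracSpan_le_expFracSpanLE (by have := mem_range.1 hκ; omega) N
  · have : κ + N + 1 = (κ + 1) + N := by omega
    rw [this]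
    exact expFracSpan_le_expFracSpanLE (by have := mem_range.1 hκ; omega) N

/-- The functions which agree generically with an element of `expFracSpanLE u Γ N d`. -/
def genericExpFrac (u : J → ℝ) (Γ : Type*) [Fintype Γ] (N d : ℕ) :
    Submodule (polyRing u) ((Γ → ℂ) → ℂ) where
  carrier := {f | ∃ g ∈ expFracSpanLE u Γ N d, f =ᶠ[genericFilter u Γ] g}
  zero_mem' := ⟨0, Submodule.zero_mem _, EventuallyEq.rfl⟩
  add_mem' := fun ⟨g₁, h₁, H₁⟩ ⟨g₂, h₂, H₂⟩ => ⟨g₁ + g₂, Submodule.add_mem _ h₁ h₂, H₁.add H₂⟩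
  smul_mem' := fun p _ ⟨g, h, H⟩ => ⟨p • g, Submodule.smul_mem _ _ h, H.const_smul p⟩

theorem genericExpFrac_mono {d d' : ℕ} (h : d ≤ d') (N : ℕ) :
    genericExpFrac u Γ N d ≤ genericExpFrac u Γ N d' :=
  fun _ ⟨g, hg, H⟩ => ⟨g, expFracSpanLE_mono h N hg, H⟩

theorem genericExpFrac_congr {N d : ℕ} {f g : (Γ → ℂ) → ℂ} (hf : f ∈ genericExpFrac u Γ N d)
    (h : g =ᶠ[genericFilter u Γ] f) : g ∈ genericExpFrac u Γ N d := by
  obtain ⟨F, hF, H⟩ := hf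
  exact ⟨F, hF, h.trans H⟩

/-- Near a generic point f coincides with its representative, so their line derivatives there
coincide as well. -/
theorem mem_genericExpFrac_of_hasLineDerivAt [DecidableEq Γ] {γ : Γ} {N d : ℕ}
    {f f' : (Γ → ℂ) → ℂ} (hf : f ∈ genericExpFrac u Γ N d)
    (h : ∀ z, HasLineDerivAt ℂ f (f' z) z (Pi.single γ 1)) :
    f' ∈ genericExpFrac u Γ N (d + 1) := by
  obtain ⟨F, hF, H⟩ := hf
  obtain ⟨G, hG, H'⟩ := expFracSpanLE_le_derivSubmodule γ N d hF
  refine ⟨G, hG, ?_⟩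
  filter_upwards [eventually_eventually_nhds_generic H, H'] with z hz hz'
  refine HasDerivAt.unique (h z) (HasDerivAt.congr_of_eventuallyEq hz' ?_)
  have hc : Tendsto (fun t : ℂ => z + t • (Pi.single γ 1 : Γ → ℂ)) (𝓝 0) (𝓝 z) := by
    have : Continuous fun t : ℂ => z + t • (Pi.single γ 1 : Γ → ℂ) := by fun_prop
    simpa using this.tendsto 0
  exact hc.eventually hz

theorem linForm_mul_left (a : Γ → ℝ) (c : ℂ) (z : Γ → ℂ) :
    linForm a (fun γ => c * z γ) = c * linForm a z := by
  simp only [linForm, mul_sum]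
  exact sum_congr rfl fun γ _ => by ring

/-- Elements of `expFracSpan u Γ m`, evaluated at `-2πi z`, as sums of quotients of numerators by
denominators; the denominators can be made to vanish on prescribed hyperplanes. -/
theorem exists_numerators_denominators {m : ℕ} {F : (Γ → ℂ) → ℂ} (hF : F ∈ expFracSpan u Γ m)
    (W : Finset (Γ → ℝ)) (hW : ∀ w ∈ W, IsForm u w) :
    ∃ (n : ℕ) (f g : Fin n → (Γ → ℂ) → ℂ), (∀ e, IsNumerator u (f e)) ∧
      (∀ e, IsDenominator u m (g e)) ∧
      (∀ z : Γ → ℂ, (Real.pi * Complex.I) ^ m * F (fun γ => -(2 * Real.pi * Complex.I) * z γ) =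
        ∑ e, f e z / g e z) ∧
      (m ≠ 0 → ∀ z, (∀ e, g e z ≠ 0) → ∀ w ∈ W, linForm w z ≠ 0) := by
  obtain ⟨n, p, G, rfl⟩ := (Submodule.mem_span_set' (R := polyRing u)).1 hF
  choose a w ha hw hG using fun i => (G i).2
  -- The first n terms are the given ones, with -2πi = (πi)(-2) accounting for the factor (-2)^(-m).
  -- The other `W.card` terms have numerator 0 and denominator the m-th power of a form of W: they
  -- add nothing to the sum, but requiring denominators to be nonzero now excludes the hyperplanes
  -- of W.
  refine ⟨n + W.card,
    Fin.append (fun i z => ((p i * (1 / (-2) ^ m) : ℝ) : ℂ) *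
      Complex.exp (Real.pi * Complex.I * linForm (fun γ => (-2) * a i γ) z)) (fun _ _ => 0),
    Fin.append (fun i z => ∏ q, linForm (w i q) z)
      (fun j z => ∏ _q : Fin m, linForm (W.equivFin.symm j : Γ → ℝ) z), ?_, ?_, ?_, ?_⟩
  · intro e
    refine Fin.addCases (fun i => ?_) (fun j => ?_) e
    · rw [Fin.append_left]
      refine ⟨_, (polyRing u).mul_mem (p i).2 ?_, _, fun γ => ?_, fun z => rfl⟩
      · have := ratCast_mem_polyRing (u := u) (1 / (-2) ^ m)
        push_cast at this
        exact this
      · have := (coeffSpace u).smul_mem (-2 : ℚ) (ha i γ)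
        rw [Rat.smul_def] at this
        push_cast at this
        exact this
    · rw [Fin.append_right]
      exact ⟨0, (polyRing u).zero_mem, 0, fun _ => (coeffSpace u).zero_mem, fun z => by simp⟩
  · intro e
    refine Fin.addCases (fun i => ?_) (fun j => ?_) e
    · rw [Fin.append_left]
      exact ⟨w i, hw i, fun z => rfl⟩
    · rw [Fin.append_right]
      exact ⟨fun _ => W.equivFin.symm j, fun _ => hW _ (W.equivFin.symm j).2, fun z => rfl⟩
  · intro z
    rw [Fin.sum_univ_add]
    simp only [Fin.append_left, Fin.append_right, zero_div, sum_const_zero, add_zero,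
      Finset.sum_apply, mul_sum, polyRing_smul_apply]
    refine sum_congr rfl fun i _ => ?_
    rw [hG i, expFrac]
    simp only [linForm_mul_left, prod_mul_distrib, prod_const, card_univ, Fintype.card_fin]
    have e1 : linForm (fun γ => (-2) * a i γ) z = (-2) * linForm (a i) z := by
      simp only [linForm, mul_sum]
      exact sum_congr rfl fun γ _ => by push_cast; ring
    have hpi : (Real.pi * Complex.I : ℂ) ≠ 0 := by simp [Real.pi_ne_zero]
    rw [e1, show -(2 * Real.pi * Complex.I) * linForm (a i) z =
      Real.pi * Complex.I * (-2 * linForm (a i) z) by ring,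
      show (-(2 * Real.pi * Complex.I : ℂ)) ^ m = (Real.pi * Complex.I) ^ m * (-2) ^ m by
        rw [← mul_pow]; ring]
    push_cast
    have h1 : ((Real.pi : ℂ) * Complex.I) ^ m ≠ 0 := pow_ne_zero _ hpi
    have h2 : ((-2 : ℂ)) ^ m ≠ 0 := pow_ne_zero _ (by norm_num)
    generalize ((Real.pi : ℂ) * Complex.I) ^ m = A at *
    generalize (-2 : ℂ) ^ m = B at *
    rw [← div_div, mul_div_assoc]
    field_simp
  -- For m = 0 the added denominators are empty products and exclude nothing; hence the hypothesis m
  -- ≠ 0.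
  · intro hm z hz v hv
    have := hz (Fin.natAdd n (W.equivFin ⟨v, hv⟩))
    simp only [Fin.append_right, Equiv.symm_apply_apply, prod_const, card_univ,
      Fintype.card_fin] at this
    exact fun h0 => this (by rw [h0, zero_pow hm])

end ExpFrac

/-! ### Step functions cut out by affine inequalities -/

section Step

open Filter Topology Finset MeasureTheory

variable {J ι Γ : Type*} [Fintype ι] [Fintype Γ]

/-- The affine functions with rational linear part and constant term in `ℚ A(y)`. -/
def affineFun (u : J → ℝ) (ι : Type*) [Fintype ι] : Submodule ℚ ((ι → ℝ) → ℝ) where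
  carrier := {f | ∃ (q : ι → ℚ), ∃ c ∈ coeffSpace u, ∀ x, f x = ∑ i, (q i : ℝ) * x i + c}
  zero_mem' := ⟨0, 0, (coeffSpace u).zero_mem, fun x => by simp⟩
  add_mem' := by
    rintro f g ⟨q, c, hc, hf⟩ ⟨r, d, hd, hg⟩
    refine ⟨q + r, c + d, (coeffSpace u).add_mem hc hd, fun x => ?_⟩
    simp only [Pi.add_apply, hf, hg, Rat.cast_add, add_mul, sum_add_distrib]
    ring
  smul_mem' := by
    rintro a f ⟨q, c, hc, hf⟩
    refine ⟨a • q, a • c, (coeffSpace u).smul_mem a hc, fun x => ?_⟩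
    simp only [Pi.smul_apply, hf, Rat.smul_def, smul_eq_mul, Rat.cast_mul, mul_add, mul_sum,
      mul_assoc]

/-- The indicator function of `0 ≤ f`. -/
def nonnegIndicator (f : (ι → ℝ) → ℝ) (x : ι → ℝ) : ℚ := if 0 ≤ f x then 1 else 0

/-- The algebra of step functions generated by the indicator functions of affine half-spaces. -/
def stepFun (u : J → ℝ) (ι : Type*) [Fintype ι] : Subalgebra ℚ ((ι → ℝ) → ℚ) :=
  Algebra.adjoin ℚ (nonnegIndicator '' (affineFun u ι : Set ((ι → ℝ) → ℝ)))

variable {u : J → ℝ}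

theorem const_mem_affineFun {c : ℝ} (hc : c ∈ coeffSpace u) :
    (fun _ => c) ∈ affineFun u ι := ⟨0, c, hc, fun x => by simp⟩

theorem coord_mem_affineFun (i : ι) : (fun x : ι → ℝ => x i) ∈ affineFun u ι := by
  classical
  exact ⟨Pi.single i 1, 0, (coeffSpace u).zero_mem, fun x => by
    rw [sum_eq_single i (fun j _ hj => by simp [hj]) (by simp)]; simp⟩

theorem continuous_of_mem_affineFun {f : (ι → ℝ) → ℝ} (hf : f ∈ affineFun u ι) :
    Continuous f := by
  obtain ⟨q, c, -, hf⟩ := hf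
  rw [funext hf]
  fun_prop

theorem nonnegIndicator_mem_stepFun {f : (ι → ℝ) → ℝ} (hf : f ∈ affineFun u ι) :
    nonnegIndicator f ∈ stepFun u ι :=
  Algebra.subset_adjoin ⟨f, hf, rfl⟩

theorem measurable_of_mem_stepFun {σ : (ι → ℝ) → ℚ} (hσ : σ ∈ stepFun u ι) : Measurable σ := by
  refine Algebra.adjoin_induction (p := fun σ _ => Measurable σ) ?_ ?_ ?_ ?_ hσ
  · rintro _ ⟨f, hf, rfl⟩
    exact Measurable.ite (measurableSet_le measurable_const
      (continuous_of_mem_affineFun hf).measurable) measurable_const measurable_const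
  · intro r; exact measurable_const
  · intro f g _ _ hf hg
    exact (measurable_of_countable fun p : ℚ × ℚ => p.1 + p.2).comp (hf.prodMk hg)
  · intro f g _ _ hf hg
    exact (measurable_of_countable fun p : ℚ × ℚ => p.1 * p.2).comp (hf.prodMk hg)

theorem exists_bound_of_mem_stepFun {σ : (ι → ℝ) → ℚ} (hσ : σ ∈ stepFun u ι) :
    ∃ C : ℝ, ∀ x, ‖(σ x : ℂ)‖ ≤ C := by
  refine Algebra.adjoin_induction (p := fun σ _ => ∃ C : ℝ, ∀ x, ‖(σ x : ℂ)‖ ≤ C) ?_ ?_ ?_ ?_ hσ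
  · rintro _ ⟨f, hf, rfl⟩
    refine ⟨1, fun x => ?_⟩
    unfold nonnegIndicator
    split_ifs <;> simp
  · intro r; exact ⟨‖((r : ℚ) : ℂ)‖, fun x => le_rfl⟩
  · rintro f g _ _ ⟨C, hC⟩ ⟨D, hD⟩
    refine ⟨C + D, fun x => ?_⟩
    rw [Pi.add_apply, Rat.cast_add]
    exact (norm_add_le _ _).trans (add_le_add (hC x) (hD x))
  · rintro f g _ _ ⟨C, hC⟩ ⟨D, hD⟩
    refine ⟨C * D, fun x => ?_⟩
    rw [Pi.mul_apply, Rat.cast_mul, norm_mul]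
    exact mul_le_mul (hC x) (hD x) (norm_nonneg _) ((norm_nonneg _).trans (hC x))

theorem measurable_cast_of_mem_stepFun {σ : (ι → ℝ) → ℚ} (hσ : σ ∈ stepFun u ι) :
    Measurable fun x => (σ x : ℂ) :=
  (measurable_of_countable fun q : ℚ => (q : ℂ)).comp (measurable_of_mem_stepFun hσ)

theorem integrableOn_stepFun_mul {σ : (ι → ℝ) → ℚ} (hσ : σ ∈ stepFun u ι) {g : (ι → ℝ) → ℂ}
    (hg : Continuous g) : IntegrableOn (fun x => (σ x : ℂ) * g x) (Set.Icc 0 1) := by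
  obtain ⟨C, hC⟩ := exists_bound_of_mem_stepFun hσ
  exact Integrable.bdd_mul (c := C) (hg.continuousOn.integrableOn_compact isCompact_Icc)
    (measurable_cast_of_mem_stepFun hσ).aestronglyMeasurable (Eventually.of_forall hC)

theorem continuous_linForm_affineFun {lam : Γ → (ι → ℝ) → ℝ} (hlam : ∀ γ, lam γ ∈ affineFun u ι)
    (z : Γ → ℂ) : Continuous fun x => linForm (fun γ => lam γ x) z := by
  have := fun γ => continuous_of_mem_affineFun (hlam γ)
  unfold linForm
  fun_prop

/-! ### Decomposition into cells -/

/-- The indicator function of the interval `[l, v]`. -/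
def intervalIndicator (l v t : ℝ) : ℚ := if l ≤ t ∧ t ≤ v then 1 else 0

/-- Cutting [l, v] by t ≤ s leaves [l, v] if v ≤ s, [l, s] if l ≤ s < v, and nothing if s < l. The
extra indicators keep the endpoints ordered on the support. -/
theorem ite_le_mul_intervalIndicator {l v : ℝ} (h : l ≤ v) (s t : ℝ) :
    (if t ≤ s then 1 else 0) * intervalIndicator l v t =
      (if v ≤ s then 1 else 0) * intervalIndicator l v t +
      (if s < v then 1 else 0) * (if l ≤ s then 1 else 0) * intervalIndicator l s t := by
  unfold intervalIndicator; grind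

theorem ite_ge_mul_intervalIndicator {l v : ℝ} (h : l ≤ v) (s t : ℝ) :
    (if s ≤ t then 1 else 0) * intervalIndicator l v t =
      (if s ≤ l then 1 else 0) * intervalIndicator l v t +
      (if l < s then 1 else 0) * (if s ≤ v then 1 else 0) * intervalIndicator s v t := by
  unfold intervalIndicator; grind

/-- The span of the functions `τ(x) 1_{l(x) ≤ t ≤ v(x)}`, where `l ≤ v` on the support of `τ`. -/
def cellSpan (u : J → ℝ) (ι : Type*) [Fintype ι] : Submodule ℚ ((ι → ℝ) → ℝ → ℚ) :=
  Submodule.span ℚ {ψ | ∃ τ ∈ stepFun u ι, ∃ l ∈ affineFun u ι, ∃ v ∈ affineFun u ι,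
    (∀ x, τ x ≠ 0 → l x ≤ v x) ∧ ψ = fun x t => τ x * intervalIndicator (l x) (v x) t}

theorem affineFun_cons {n : ℕ} {f : (Fin (n + 1) → ℝ) → ℝ} (hf : f ∈ affineFun u (Fin (n + 1))) :
    ∃ (q : ℚ), ∃ g ∈ affineFun u (Fin n), ∀ (x : Fin n → ℝ) (t : ℝ),
      f (Fin.cons t x : Fin (n + 1) → ℝ) = q * t + g x := by
  obtain ⟨q, c, hc, hf⟩ := hf
  refine ⟨q 0, fun x => ∑ i : Fin n, (q i.succ : ℝ) * x i + c, ⟨_, c, hc, fun x => rfl⟩,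
    fun x t => ?_⟩
  rw [hf, Fin.sum_univ_succ]
  simp only [Fin.cons_zero, Fin.cons_succ]
  ring

theorem stepFun_mul_le_mem {τ : (ι → ℝ) → ℚ} (hτ : τ ∈ stepFun u ι) {f g : (ι → ℝ) → ℝ}
    (hf : f ∈ affineFun u ι) (hg : g ∈ affineFun u ι) :
    (fun x => τ x * if f x ≤ g x then 1 else 0) ∈ stepFun u ι := by
  have := (stepFun u ι).mul_mem hτ
    (nonnegIndicator_mem_stepFun ((affineFun u ι).sub_mem hg hf))
  convert this using 2 with x
  simp [nonnegIndicator]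

theorem stepFun_mul_lt_mem {τ : (ι → ℝ) → ℚ} (hτ : τ ∈ stepFun u ι) {f g : (ι → ℝ) → ℝ}
    (hf : f ∈ affineFun u ι) (hg : g ∈ affineFun u ι) :
    (fun x => τ x * if f x < g x then 1 else 0) ∈ stepFun u ι := by
  have := (stepFun u ι).sub_mem hτ (stepFun_mul_le_mem hτ hg hf)
  convert this using 2 with x
  rcases lt_or_ge (f x) (g x) with h | h
  · simp [h, not_le.2 h]
  · simp [h, not_lt.2 h]

theorem cell_mem {τ : (ι → ℝ) → ℚ} (hτ : τ ∈ stepFun u ι) {l v : (ι → ℝ) → ℝ}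
    (hl : l ∈ affineFun u ι) (hv : v ∈ affineFun u ι) (h : ∀ x, τ x ≠ 0 → l x ≤ v x) :
    (fun x t => τ x * intervalIndicator (l x) (v x) t) ∈ cellSpan u ι :=
  Submodule.subset_span ⟨τ, hτ, l, hl, v, hv, h, rfl⟩

/-- In the fibre variable t the condition q t + g(x) ≥ 0 is an upper bound, a condition on x alone,
or a lower bound, by the sign of q. Since q is rational, the new endpoint -g/q is again in
`affineFun`. -/
theorem nonnegIndicator_mul_mem_cellSpan {n : ℕ} {f : (Fin (n + 1) → ℝ) → ℝ}
    (hf : f ∈ affineFun u (Fin (n + 1))) {ψ : (Fin n → ℝ) → ℝ → ℚ}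
    (hψ : ψ ∈ cellSpan u (Fin n)) :
    (fun x t => nonnegIndicator f (Fin.cons t x) * ψ x t) ∈ cellSpan u (Fin n) := by
  obtain ⟨q, g, hg, hfg⟩ := affineFun_cons hf
  simp only [nonnegIndicator, hfg]
  refine Submodule.span_induction (p := fun ψ _ => (fun x t => (if 0 ≤ (q : ℝ) * t + g x then
    (1 : ℚ) else 0) * ψ x t) ∈ cellSpan u (Fin n)) ?_ ?_ ?_ ?_ hψ
  · rintro _ ⟨τ, hτ, l, hl, v, hv, hlv, rfl⟩
    rcases lt_trichotomy q 0 with hq | hq | hq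
    · have hq' : (q : ℝ) < 0 := by exact_mod_cast hq
      have hs : (fun x => (-q⁻¹) • g x) ∈ affineFun u (Fin n) := (affineFun u _).smul_mem _ hg
      set s : (Fin n → ℝ) → ℝ := fun x => (-q⁻¹) • g x with hsdef
      have key (x : Fin n → ℝ) (t : ℝ) : 0 ≤ (q : ℝ) * t + g x ↔ t ≤ s x := by
        have : (q : ℝ) * t + g x = q * (t - s x) := by
          simp only [hsdef, Rat.smul_def]; push_cast; rw [mul_sub, ← mul_assoc, mul_neg,
            mul_inv_cancel₀ hq'.ne]; ring
        rw [this]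
        exact ⟨fun h => by nlinarith, fun h => by nlinarith⟩
      have h1 := cell_mem (stepFun_mul_le_mem hτ hv hs) hl hv
        fun x hx => hlv x (left_ne_zero_of_mul hx)
      have h2 := cell_mem (stepFun_mul_le_mem (stepFun_mul_lt_mem hτ hs hv) hl hs) hl hs
        fun x hx => by by_contra h; simp [h] at hx
      convert (cellSpan u (Fin n)).add_mem h1 h2 using 1
      funext x t
      simp only [Pi.add_apply, key]
      rcases eq_or_ne (τ x) 0 with h0 | h0
      · simp [h0]
      linear_combination τ x * ite_le_mul_intervalIndicator (hlv x h0) (s x) t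
    · have h1 := cell_mem (stepFun_mul_le_mem hτ (affineFun u (Fin n)).zero_mem hg) hl hv
        fun x hx => hlv x (left_ne_zero_of_mul hx)
      convert h1 using 3 with x t
      simp only [hq, Rat.cast_zero, zero_mul, zero_add, Pi.zero_apply]
      ring
    · have hq' : 0 < (q : ℝ) := by exact_mod_cast hq
      have hs : (fun x => (-q⁻¹) • g x) ∈ affineFun u (Fin n) := (affineFun u _).smul_mem _ hg
      set s : (Fin n → ℝ) → ℝ := fun x => (-q⁻¹) • g x with hsdef
      have key (x : Fin n → ℝ) (t : ℝ) : 0 ≤ (q : ℝ) * t + g x ↔ s x ≤ t := by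
        have : (q : ℝ) * t + g x = q * (t - s x) := by
          simp only [hsdef, Rat.smul_def]; push_cast; rw [mul_sub, ← mul_assoc, mul_neg,
            mul_inv_cancel₀ hq'.ne']; ring
        rw [this, mul_nonneg_iff_of_pos_left hq', sub_nonneg]
      have h1 := cell_mem (stepFun_mul_le_mem hτ hs hl) hl hv
        fun x hx => hlv x (left_ne_zero_of_mul hx)
      have h2 := cell_mem (stepFun_mul_le_mem (stepFun_mul_lt_mem hτ hl hs) hs hv) hs hv
        fun x hx => by by_contra h; simp [h] at hx
      convert (cellSpan u (Fin n)).add_mem h1 h2 using 1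
      funext x t
      simp only [Pi.add_apply, key]
      rcases eq_or_ne (τ x) 0 with h0 | h0
      · simp [h0]
      linear_combination τ x * ite_ge_mul_intervalIndicator (hlv x h0) (s x) t
  · simp only [Pi.zero_apply, mul_zero]
    exact (cellSpan u (Fin n)).zero_mem
  · intro a b _ _ ha hb
    simp only [Pi.add_apply, mul_add]
    exact (cellSpan u (Fin n)).add_mem ha hb
  · intro c a _ ha
    simp only [Pi.smul_apply, smul_eq_mul, mul_left_comm _ c]
    exact (cellSpan u (Fin n)).smul_mem c ha

theorem stepFun_mul_mem_cellSpan {n : ℕ} {σ : (Fin (n + 1) → ℝ) → ℚ}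
    (hσ : σ ∈ stepFun u (Fin (n + 1))) {ψ : (Fin n → ℝ) → ℝ → ℚ} (hψ : ψ ∈ cellSpan u (Fin n)) :
    (fun x t => σ (Fin.cons t x) * ψ x t) ∈ cellSpan u (Fin n) := by
  refine Algebra.adjoin_induction (p := fun σ _ => ∀ ψ ∈ cellSpan u (Fin n),
    (fun x t => σ (Fin.cons t x) * ψ x t) ∈ cellSpan u (Fin n)) ?_ ?_ ?_ ?_ hσ ψ hψ
  · rintro _ ⟨f, hf, rfl⟩ ψ hψ
    exact nonnegIndicator_mul_mem_cellSpan hf hψ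
  · intro r ψ hψ
    exact (cellSpan u (Fin n)).smul_mem r hψ
  · intro f g _ _ hf hg ψ hψ
    simp only [Pi.add_apply, add_mul]
    exact (cellSpan u (Fin n)).add_mem (hf ψ hψ) (hg ψ hψ)
  · intro f g _ _ hf hg ψ hψ
    simp only [Pi.mul_apply, mul_assoc]
    exact hf _ (hg ψ hψ)

theorem stepFun_mul_unitInterval_mem_cellSpan {n : ℕ} {σ : (Fin (n + 1) → ℝ) → ℚ}
    (hσ : σ ∈ stepFun u (Fin (n + 1))) :
    (fun x t => σ (Fin.cons t x) * intervalIndicator 0 1 t) ∈ cellSpan u (Fin n) := by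
  refine stepFun_mul_mem_cellSpan hσ ?_
  have := cell_mem (u := u) (stepFun u (Fin n)).one_mem
    (const_mem_affineFun (coeffSpace u).zero_mem)
    (const_mem_affineFun (Submodule.subset_span (Set.mem_insert 1 _))) fun x _ => zero_le_one
  simpa using this

end Step

/-! ### Integrals of step functions against exponentials -/

section StepIntegral

open Filter Topology Finset MeasureTheory

variable {J ι Γ : Type*} [Fintype ι] [Fintype Γ] {u : J → ℝ}

theorem integral_Icc_fin_succ {n : ℕ} {f : (Fin (n + 1) → ℝ) → ℂ}
    (hf : IntegrableOn f (Set.Icc 0 1)) :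
    ∫ x in Set.Icc 0 1, f x =
      ∫ x in Set.Icc (0 : Fin n → ℝ) 1, ∫ t in Set.Icc (0 : ℝ) 1, f (Fin.cons t x) := by
  have hmp := (volume_preserving_piFinSuccAbove (fun _ : Fin (n + 1) => ℝ) 0).symm
  have he := (MeasurableEquiv.piFinSuccAbove (fun _ : Fin (n + 1) => ℝ) 0).symm.measurableEmbedding
  have hpre : (MeasurableEquiv.piFinSuccAbove (fun _ : Fin (n + 1) => ℝ) 0).symm ⁻¹'
      (Set.Icc 0 1) = Set.Icc (0 : ℝ) 1 ×ˢ Set.Icc (0 : Fin n → ℝ) 1 := by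
    ext ⟨t, x⟩
    simp only [MeasurableEquiv.piFinSuccAbove_symm_apply, Fin.insertNthEquiv_apply,
      Fin.insertNth_zero', Set.mem_preimage, Set.mem_Icc, Set.mem_prod, Pi.le_def,
      Fin.forall_fin_succ, Fin.cons_zero, Fin.cons_succ, Pi.zero_apply, Pi.one_apply]
    tauto
  have hfi := (hmp.integrableOn_comp_preimage he).2 hf
  rw [← hmp.setIntegral_preimage_emb he, hpre]
  rw [hpre] at hfi
  simp only [MeasurableEquiv.piFinSuccAbove_symm_apply, Function.comp_def] at hfi ⊢
  rw [IntegrableOn, Measure.volume_eq_prod, ← Measure.prod_restrict] at hfi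
  rw [Measure.volume_eq_prod, ← Measure.prod_restrict, integral_prod_symm _ hfi]
  simp only [Fin.insertNthEquiv, Equiv.coe_fn_mk, Fin.insertNth_zero']

theorem integral_intervalIndicator_mul_exp {l v : ℝ} (h : l ≤ v) {w : ℂ} (hw : w ≠ 0) (c : ℂ) :
    ∫ t : ℝ, (intervalIndicator l v t : ℂ) * Complex.exp (t * w + c) =
      (Complex.exp (v * w + c) - Complex.exp (l * w + c)) / w := by
  have h1 : (fun t : ℝ => (intervalIndicator l v t : ℂ) * Complex.exp (t * w + c)) =
      Set.indicator (Set.Icc l v) fun t : ℝ => Complex.exp c * Complex.exp (w * t) := by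
    funext t
    rw [Set.indicator_apply, intervalIndicator]
    simp only [Set.mem_Icc]
    split_ifs
    · rw [← Complex.exp_add]; simp only [Rat.cast_one, one_mul]; ring_nf
    · simp
  rw [h1, integral_indicator measurableSet_Icc, integral_Icc_eq_integral_Ioc,
    ← intervalIntegral.integral_of_le h, intervalIntegral.integral_const_mul,
    integral_exp_mul_complex hw, mul_div_assoc', mul_sub, ← Complex.exp_add, ← Complex.exp_add]
  ring_nf

theorem integrable_intervalIndicator_mul_exp (l v : ℝ) (w c : ℂ) :
    Integrable fun t : ℝ => (intervalIndicator l v t : ℂ) * Complex.exp (t * w + c) := by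
  have h1 : (fun t : ℝ => (intervalIndicator l v t : ℂ) * Complex.exp (t * w + c)) =
      Set.indicator (Set.Icc l v) fun t : ℝ => Complex.exp (t * w + c) := by
    funext t
    rw [Set.indicator_apply, intervalIndicator]
    simp only [Set.mem_Icc]
    split_ifs <;> simp
  rw [h1, integrable_indicator_iff measurableSet_Icc]
  exact (by fun_prop : Continuous fun t : ℝ => Complex.exp (t * w + c)).continuousOn.integrableOn_Icc

theorem div_linForm_mem_genericExpFrac {w : Γ → ℝ} (hw : IsForm u w) {N d : ℕ}
    {f : (Γ → ℂ) → ℂ} (hf : f ∈ genericExpFrac u Γ N d) :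
    (fun z => f z / linForm w z) ∈ genericExpFrac u Γ (N + 1) d := by
  obtain ⟨F, hF, H⟩ := hf
  refine ⟨divForm u w F, ?_, ?_⟩
  · have := Submodule.mem_map_of_mem (f := divForm u w) hF
    simp only [expFracSpanLE, Submodule.map_iSup] at this
    exact iSup₂_mono (fun κ _ => map_divForm_expFracSpan_le hw (κ + N)) this
  · filter_upwards [H] with z hz
    simp [divForm, hz]

/-- A nonzero rational form is proportional to a form with integral coefficients. -/
theorem exists_isForm_of_rat {q : Γ → ℚ} (hq : q ≠ 0) :
    ∃ M : ℚ, M ≠ 0 ∧ IsForm u fun γ => ((M * q γ : ℚ) : ℝ) := by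
  refine ⟨((∏ γ, (q γ).den : ℕ) : ℚ), ?_, ?_, fun γ => ?_⟩
  · exact_mod_cast Finset.prod_ne_zero_iff.2 fun γ _ => (q γ).den_ne_zero
  · obtain ⟨γ, hγ⟩ := Function.ne_iff.1 hq
    refine Function.ne_iff.2 ⟨γ, ?_⟩
    have : ((∏ γ, (q γ).den : ℕ) : ℚ) ≠ 0 := by
      exact_mod_cast Finset.prod_ne_zero_iff.2 fun γ _ => (q γ).den_ne_zero
    exact Rat.cast_ne_zero.2 (mul_ne_zero this hγ)
  · obtain ⟨k, hk⟩ := Finset.dvd_prod_of_mem (fun γ => (q γ).den) (mem_univ γ)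
    have : ((∏ γ, (q γ).den : ℕ) : ℚ) * q γ = ((k * (q γ).num : ℤ) : ℚ) := by
      rw [hk]
      have := Rat.den_mul_eq_num (q γ)
      push_cast
      rw [← this]; ring
    simp only [this, Rat.cast_intCast]
    have h1 : (1 : ℝ) ∈ coeffGroup u := AddSubgroup.subset_closure (Set.mem_insert 1 _)
    simpa using (coeffGroup u).zsmul_mem h1 (k * (q γ).num)

theorem linForm_add_mul (q : Γ → ℝ) (a : Γ → ℝ) (t : ℝ) (z : Γ → ℂ) :
    linForm (fun γ => q γ * t + a γ) z = t * linForm q z + linForm a z := by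
  simp only [linForm, mul_sum, ← sum_add_distrib]
  exact sum_congr rfl fun γ _ => by push_cast; ring

theorem ratCast_smul_mem_genericExpFrac {N d : ℕ} (c : ℚ) {f : (Γ → ℂ) → ℂ}
    (hf : f ∈ genericExpFrac u Γ N d) :
    (fun z => (c : ℂ) * f z) ∈ genericExpFrac u Γ N d := by
  have := (genericExpFrac u Γ N d).smul_mem ⟨(c : ℝ), ratCast_mem_polyRing c⟩ hf
  convert this using 1
  funext z
  rw [polyRing_smul_apply]
  simp

/-- The integral of a step function against `exp (∑ z_γ λ_γ(x))` over the unit cube, for affine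
functions `λ_γ` separating points. -/
theorem integral_stepFun_mul_exp_mem (n : ℕ) {σ : (Fin n → ℝ) → ℚ} (hσ : σ ∈ stepFun u (Fin n))
    {lam : Γ → (Fin n → ℝ) → ℝ} (hlam : ∀ γ, lam γ ∈ affineFun u (Fin n))
    (hinj : Function.Injective fun x γ => lam γ x) :
    (fun z => ∫ x in Set.Icc (0 : Fin n → ℝ) 1,
      (σ x : ℂ) * Complex.exp (linForm (fun γ => lam γ x) z)) ∈ genericExpFrac u Γ n 0 := by
  induction n with
  | zero =>
    have hc (γ : Γ) : lam γ 0 ∈ coeffSpace u := by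
      obtain ⟨q, c, hc, h⟩ := hlam γ
      rw [h]; simpa using hc
    have hm := ratCast_smul_mem_genericExpFrac (σ 0) (u := u)
      (f := expFrac (fun γ => lam γ 0) (Fin.elim0 : Fin 0 → Γ → ℝ)) (N := 0) (d := 0)
      ⟨_, expFracSpan_le_expFracSpanLE le_rfl 0 (expFrac_mem hc fun q => q.elim0),
        EventuallyEq.rfl⟩
    convert hm using 2 with z
    have hI : (Set.Icc (0 : Fin 0 → ℝ) 1) = Set.univ := by
      ext x; simp [Subsingleton.elim x 0, Subsingleton.elim (1 : Fin 0 → ℝ) 0]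
    rw [hI, setIntegral_univ, volume_pi, Measure.pi_of_empty (fun _ : Fin 0 => volume) 0,
      integral_dirac]
    simp [expFrac]
  | succ n ih =>
    choose q g hg hqg using fun γ => affineFun_cons (hlam γ)
    -- Separation of points means that the variable t really occurs, so the form to divide by is
    -- nonzero.
    have hq : q ≠ 0 := by
      intro h
      have : (fun γ => lam γ (Fin.cons (1 : ℝ) (0 : Fin n → ℝ) : Fin (n + 1) → ℝ)) =
          fun γ => lam γ (Fin.cons (0 : ℝ) (0 : Fin n → ℝ) : Fin (n + 1) → ℝ) := by
        funext γ; rw [hqg, hqg, h]; simp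
      have := congrFun (hinj this) 0
      simp at this
    obtain ⟨M, hM0, hM⟩ := exists_isForm_of_rat (u := u) hq
    have hMlin (z : Γ → ℂ) : linForm (fun γ => ((M * q γ : ℚ) : ℝ)) z =
        M * linForm (fun γ => (q γ : ℝ)) z := by
      simp only [linForm, mul_sum]
      exact sum_congr rfl fun γ _ => by push_cast; ring
    have hlin (z : Γ → ℂ) (x : Fin n → ℝ) (t : ℝ) :
        linForm (fun γ => lam γ (Fin.cons t x : Fin (n + 1) → ℝ)) z =
          t * linForm (fun γ => (q γ : ℝ)) z + linForm (fun γ => g γ x) z := by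
      simp only [hqg, linForm_add_mul]
    -- substitution of an affine function for the first variable
    have hsub {s : (Fin n → ℝ) → ℝ} (hs : s ∈ affineFun u (Fin n)) (γ : Γ) :
        (fun x => lam γ (Fin.cons (s x) x : Fin (n + 1) → ℝ)) ∈ affineFun u (Fin n) := by
      have := (affineFun u (Fin n)).add_mem ((affineFun u (Fin n)).smul_mem (q γ) hs) (hg γ)
      convert this using 2 with x
      rw [hqg]; simp [Rat.smul_def]
    have hsubinj (s : (Fin n → ℝ) → ℝ) : Function.Injective
        fun x γ => lam γ (Fin.cons (s x) x : Fin (n + 1) → ℝ) := by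
      intro x y hxy
      have := hinj hxy
      exact (Fin.cons_inj.1 this).2
    -- Both integrability clauses are carried along because additivity of the iterated integral
    -- needs them. The outer one is stated generically, since it comes from the evaluation of the
    -- inner integral.
    have hcell : ∀ ψ ∈ cellSpan u (Fin n),
        (∀ z x, Integrable fun t : ℝ => (ψ x t : ℂ) *
          Complex.exp (linForm (fun γ => lam γ (Fin.cons t x : Fin (n + 1) → ℝ)) z)) ∧
        (∀ᶠ z in genericFilter u Γ, IntegrableOn (fun x => ∫ t : ℝ, (ψ x t : ℂ) *
          Complex.exp (linForm (fun γ => lam γ (Fin.cons t x : Fin (n + 1) → ℝ)) z))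
            (Set.Icc 0 1)) ∧
        (fun z => ∫ x in Set.Icc (0 : Fin n → ℝ) 1, ∫ t : ℝ, (ψ x t : ℂ) *
          Complex.exp (linForm (fun γ => lam γ (Fin.cons t x : Fin (n + 1) → ℝ)) z)) ∈
            genericExpFrac u Γ (n + 1) 0 := by
      intro ψ hψ
      refine Submodule.span_induction (p := fun ψ _ =>
        (∀ z x, Integrable fun t : ℝ => (ψ x t : ℂ) *
          Complex.exp (linForm (fun γ => lam γ (Fin.cons t x : Fin (n + 1) → ℝ)) z)) ∧
        (∀ᶠ z in genericFilter u Γ, IntegrableOn (fun x => ∫ t : ℝ, (ψ x t : ℂ) *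
          Complex.exp (linForm (fun γ => lam γ (Fin.cons t x : Fin (n + 1) → ℝ)) z))
            (Set.Icc 0 1)) ∧
        (fun z => ∫ x in Set.Icc (0 : Fin n → ℝ) 1, ∫ t : ℝ, (ψ x t : ℂ) *
          Complex.exp (linForm (fun γ => lam γ (Fin.cons t x : Fin (n + 1) → ℝ)) z)) ∈
            genericExpFrac u Γ (n + 1) 0) ?_ ?_ ?_ ?_ hψ
      · rintro _ ⟨τ, hτ, l, hl, v, hv, hlv, rfl⟩
        -- The inner integral is a difference of exponentials at the endpoints v(x), l(x), divided
        -- by one form. The substituted functions are still affine and separate points, so the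
        -- induction hypothesis applies to each.
        have hval : ∀ᶠ z in genericFilter u Γ, ∀ x, ∫ t : ℝ,
            ((τ x * intervalIndicator (l x) (v x) t : ℚ) : ℂ) *
            Complex.exp (linForm (fun γ => lam γ (Fin.cons t x : Fin (n + 1) → ℝ)) z) =
            ((τ x : ℂ) * Complex.exp (linForm
                (fun γ => lam γ (Fin.cons (v x) x : Fin (n + 1) → ℝ)) z) -
              (τ x : ℂ) * Complex.exp (linForm
                (fun γ => lam γ (Fin.cons (l x) x : Fin (n + 1) → ℝ)) z)) *
              (M / linForm (fun γ => ((M * q γ : ℚ) : ℝ)) z) := by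
          filter_upwards [eventually_linForm_ne hM] with z hz x
          have hM' : (M : ℂ) ≠ 0 := by exact_mod_cast hM0
          rw [hMlin] at hz ⊢
          have hz' := right_ne_zero_of_mul hz
          simp only [hlin, Rat.cast_mul, mul_assoc]
          rw [integral_const_mul]
          rcases eq_or_ne (τ x) 0 with h0 | h0
          · simp [h0]
          rw [integral_intervalIndicator_mul_exp (hlv x h0) hz']
          field_simp
        have hint (s : (Fin n → ℝ) → ℝ) (hs : s ∈ affineFun u (Fin n)) (z : Γ → ℂ) :
            IntegrableOn (fun x => (τ x : ℂ) * Complex.exp (linForm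
                (fun γ => lam γ (Fin.cons (s x) x : Fin (n + 1) → ℝ)) z)) (Set.Icc 0 1) :=
          integrableOn_stepFun_mul hτ
            (Complex.continuous_exp.comp (continuous_linForm_affineFun (hsub hs) z))
        refine ⟨fun z x => ?_, ?_, ?_⟩
        · simp only [hlin, Rat.cast_mul, mul_assoc]
          exact (integrable_intervalIndicator_mul_exp _ _ _ _).const_mul _
        · filter_upwards [hval] with z hz
          simp only [hz]
          exact ((hint v hv z).sub (hint l hl z)).mul_const _
        · have h1 := (genericExpFrac u Γ n 0).sub_mem (ih hτ (hsub hv) (hsubinj v))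
            (ih hτ (hsub hl) (hsubinj l))
          refine genericExpFrac_congr (div_linForm_mem_genericExpFrac hM
            (ratCast_smul_mem_genericExpFrac M h1)) ?_
          filter_upwards [hval] with z hz
          simp only [hz]
          rw [integral_mul_const, integral_sub (hint v hv z) (hint l hl z)]
          simp only [Pi.sub_apply]
          ring
      · refine ⟨fun z x => by simp, Eventually.of_forall fun z => by simp, ?_⟩
        simp only [Pi.zero_apply, Rat.cast_zero, zero_mul, integral_zero]
        exact (genericExpFrac u Γ (n + 1) 0).zero_mem
      · rintro a b _ _ ⟨ha1, ha2, ha3⟩ ⟨hb1, hb2, hb3⟩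
        have hadd (z : Γ → ℂ) (x : Fin n → ℝ) := integral_add (ha1 z x) (hb1 z x)
        simp only [Pi.add_apply, Rat.cast_add, add_mul, hadd]
        refine ⟨fun z x => (ha1 z x).add (hb1 z x), ?_, ?_⟩
        · filter_upwards [ha2, hb2] with z hz1 hz2 using hz1.add hz2
        · refine genericExpFrac_congr ((genericExpFrac u Γ (n + 1) 0).add_mem ha3 hb3) ?_
          filter_upwards [ha2, hb2] with z hz1 hz2
          exact integral_add hz1 hz2
      · rintro c a _ ⟨ha1, ha2, ha3⟩
        simp only [Pi.smul_apply, smul_eq_mul, Rat.cast_mul, mul_assoc, integral_const_mul]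
        refine ⟨fun z x => (ha1 z x).const_mul _, ?_, ratCast_smul_mem_genericExpFrac c ha3⟩
        filter_upwards [ha2] with z hz using hz.const_mul _
    obtain ⟨-, -, h⟩ := hcell _ (stepFun_mul_unitInterval_mem_cellSpan hσ)
    convert h using 2 with z
    rw [integral_Icc_fin_succ (integrableOn_stepFun_mul hσ
      (continuous_linForm_affineFun hlam z).cexp)]
    congr 1
    funext x
    rw [← integral_indicator measurableSet_Icc]
    congr 1
    funext t
    rw [Set.indicator_apply, intervalIndicator]
    simp only [Set.mem_Icc]
    split_ifs <;> simp

end StepIntegral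

/-! ### Piecewise polynomial functions on the unit cube -/

section PiecewisePolynomial

open Filter Topology Finset MeasureTheory

variable {J Γ : Type*} [Fintype Γ] {u : J → ℝ}

/-- The linear form `linForm a` as a continuous linear map. -/
def linFormCLM (a : Γ → ℝ) : (Γ → ℂ) →L[ℂ] ℂ :=
  ∑ γ, (a γ : ℂ) • ContinuousLinearMap.proj γ

theorem linFormCLM_apply (a : Γ → ℝ) (z : Γ → ℂ) : linFormCLM a z = linForm a z := by
  simp [linFormCLM, linForm]

theorem norm_linFormCLM_le {a : Γ → ℝ} (ha : a ∈ Set.Icc 0 1) :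
    ‖linFormCLM a‖ ≤ Fintype.card Γ := by
  refine ContinuousLinearMap.opNorm_le_bound _ (Nat.cast_nonneg _) fun z => ?_
  rw [linFormCLM_apply, linForm]
  refine (norm_sum_le _ _).trans ?_
  calc ∑ γ, ‖(a γ : ℂ) * z γ‖ ≤ ∑ _γ : Γ, ‖z‖ := by
        refine sum_le_sum fun γ _ => ?_
        rw [norm_mul, Complex.norm_real, Real.norm_of_nonneg (ha.1 γ)]
        exact (mul_le_of_le_one_left (norm_nonneg _) (ha.2 γ)).trans (norm_le_pi_norm z γ)
    _ = Fintype.card Γ * ‖z‖ := by simp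

theorem continuous_linFormCLM : Continuous (linFormCLM : (Γ → ℝ) → (Γ → ℂ) →L[ℂ] ℂ) := by
  unfold linFormCLM
  exact continuous_finsetSum _ fun γ _ =>
    (Complex.continuous_ofReal.comp (continuous_apply γ)).smul continuous_const

theorem continuous_linForm_left (z : Γ → ℂ) : Continuous fun x : Γ → ℝ => linForm x z := by
  unfold linForm; fun_prop

/-- Essentially bounded measurable functions on the unit cube. -/
def IsBddOnCube (ψ : (Γ → ℝ) → ℂ) : Prop :=
  AEStronglyMeasurable ψ (volume.restrict (Set.Icc 0 1)) ∧
    ∃ C, ∀ᵐ x ∂volume.restrict (Set.Icc (0 : Γ → ℝ) 1), ‖ψ x‖ ≤ C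

theorem IsBddOnCube.integrable_mul {ψ : (Γ → ℝ) → ℂ} (h : IsBddOnCube ψ) {g : (Γ → ℝ) → ℂ}
    (hg : Continuous g) : IntegrableOn (fun x => ψ x * g x) (Set.Icc 0 1) := by
  obtain ⟨h1, C, hC⟩ := h
  exact Integrable.bdd_mul (c := C) (hg.continuousOn.integrableOn_compact isCompact_Icc) h1 hC

theorem IsBddOnCube.integrable_mul_exp {ψ : (Γ → ℝ) → ℂ} (h : IsBddOnCube ψ) (z : Γ → ℂ) :
    IntegrableOn (fun x => ψ x * Complex.exp (linForm x z)) (Set.Icc 0 1) :=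
  h.integrable_mul (continuous_linForm_left z).cexp

theorem IsBddOnCube.mul {ψ φ : (Γ → ℝ) → ℂ} (h : IsBddOnCube ψ) (h' : IsBddOnCube φ) :
    IsBddOnCube fun x => ψ x * φ x := by
  obtain ⟨h1, C, hC⟩ := h
  obtain ⟨h1', C', hC'⟩ := h'
  refine ⟨h1.mul h1', C * C', ?_⟩
  filter_upwards [hC, hC'] with x hx hx'
  rw [norm_mul]
  exact mul_le_mul hx hx' (norm_nonneg _) ((norm_nonneg _).trans hx)

theorem IsBddOnCube.add {ψ φ : (Γ → ℝ) → ℂ} (h : IsBddOnCube ψ) (h' : IsBddOnCube φ) :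
    IsBddOnCube fun x => ψ x + φ x := by
  obtain ⟨h1, C, hC⟩ := h
  obtain ⟨h1', C', hC'⟩ := h'
  refine ⟨h1.add h1', C + C', ?_⟩
  filter_upwards [hC, hC'] with x hx hx'
  exact (norm_add_le _ _).trans (add_le_add hx hx')

theorem IsBddOnCube.of_continuous {ψ : (Γ → ℝ) → ℂ} (h : Continuous ψ) : IsBddOnCube ψ := by
  obtain ⟨C, hC⟩ := isCompact_Icc.exists_bound_of_continuousOn
    (h.continuousOn (s := Set.Icc (0 : Γ → ℝ) 1))
  exact ⟨h.aestronglyMeasurable, C, ae_restrict_of_forall_mem measurableSet_Icc hC⟩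

theorem IsBddOnCube.congr {ψ φ : (Γ → ℝ) → ℂ} (h : IsBddOnCube ψ)
    (h' : φ =ᵐ[volume.restrict (Set.Icc 0 1)] ψ) : IsBddOnCube φ := by
  obtain ⟨h1, C, hC⟩ := h
  refine ⟨h1.congr h'.symm, C, ?_⟩
  filter_upwards [hC, h'] with x hx hx'
  rwa [hx']

theorem IsBddOnCube.of_stepFun {σ : (Γ → ℝ) → ℚ} (hσ : σ ∈ stepFun u Γ) :
    IsBddOnCube fun x => (σ x : ℂ) := by
  obtain ⟨C, hC⟩ := exists_bound_of_mem_stepFun hσ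
  exact ⟨(measurable_cast_of_mem_stepFun hσ).aestronglyMeasurable, C, Eventually.of_forall hC⟩

/-- The Laplace transform of a bounded function on the unit cube. -/
def cubeLaplace (ψ : (Γ → ℝ) → ℂ) (z : Γ → ℂ) : ℂ :=
  ∫ x in Set.Icc (0 : Γ → ℝ) 1, ψ x * Complex.exp (linForm x z)

/-- Dominated differentiation: on the cube and on the unit ball about z₀ the exponent has norm at
most card Γ · (‖z₀‖ + 1). -/
theorem IsBddOnCube.hasFDerivAt_cubeLaplace {ψ : (Γ → ℝ) → ℂ} (h : IsBddOnCube ψ) (z₀ : Γ → ℂ) :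
    Integrable (fun x => (ψ x * Complex.exp (linForm x z₀)) • linFormCLM x)
      (volume.restrict (Set.Icc 0 1)) ∧
    HasFDerivAt (cubeLaplace ψ)
      (∫ x in Set.Icc (0 : Γ → ℝ) 1, (ψ x * Complex.exp (linForm x z₀)) • linFormCLM x) z₀ := by
  obtain ⟨h1, C, hC⟩ := id h
  have hmeas : AEStronglyMeasurable (fun x => (ψ x * Complex.exp (linForm x z₀)) • linFormCLM x)
      (volume.restrict (Set.Icc (0 : Γ → ℝ) 1)) :=
    (h.integrable_mul_exp z₀).aestronglyMeasurable.smul continuous_linFormCLM.aestronglyMeasurable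
  have hbound : ∀ᵐ x ∂volume.restrict (Set.Icc (0 : Γ → ℝ) 1), ∀ z ∈ Metric.ball z₀ 1,
        ‖(ψ x * Complex.exp (linForm x z)) • linFormCLM x‖ ≤
          C * Real.exp (Fintype.card Γ * (‖z₀‖ + 1)) * Fintype.card Γ := by
    filter_upwards [hC, ae_restrict_mem measurableSet_Icc] with x hx hxI z hz
    have hC0 : 0 ≤ C := (norm_nonneg _).trans hx
    have hL := norm_linFormCLM_le hxI
    have hz' : ‖z‖ ≤ ‖z₀‖ + 1 := by
      have := norm_sub_norm_le z z₀
      have h2 := mem_ball_iff_norm.1 hz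
      linarith
    have hE : ‖Complex.exp (linForm x z)‖ ≤ Real.exp (Fintype.card Γ * (‖z₀‖ + 1)) := by
      refine (Complex.norm_exp_le_exp_norm _).trans (Real.exp_le_exp.2 ?_)
      rw [← linFormCLM_apply]
      refine ((linFormCLM x).le_opNorm z).trans ?_
      gcongr
    rw [norm_smul, norm_mul]
    gcongr
  refine ⟨?_, ?_⟩
  · refine Integrable.mono' (g := fun _ =>
      C * Real.exp (Fintype.card Γ * (‖z₀‖ + 1)) * Fintype.card Γ)
      (integrableOn_const (by simp [isCompact_Icc.measure_lt_top.ne])) hmeas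
      (hbound.mono fun x hx => hx z₀ (Metric.mem_ball_self one_pos))
  · refine hasFDerivAt_integral_of_dominated_of_fderiv_le (𝕜 := ℂ)
      (F := fun z x => ψ x * Complex.exp (linForm x z))
      (F' := fun z x => (ψ x * Complex.exp (linForm x z)) • linFormCLM x)
      (bound := fun _ => C * Real.exp (Fintype.card Γ * (‖z₀‖ + 1)) * Fintype.card Γ)
      (Metric.ball_mem_nhds z₀ one_pos)
      (Eventually.of_forall fun z => (h.integrable_mul_exp z).aestronglyMeasurable)
      (h.integrable_mul_exp z₀) hmeas hbound
      (integrableOn_const (by simp [isCompact_Icc.measure_lt_top.ne])) ?_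
    refine Eventually.of_forall fun x z _ => ?_
    have h2 : HasFDerivAt (fun z => linForm x z) (linFormCLM x) z := by
      have := (linFormCLM x).hasFDerivAt (x := z)
      simpa only [← linFormCLM_apply] using this
    have := (h2.cexp).const_mul (ψ x)
    rwa [smul_smul] at this

theorem IsBddOnCube.hasLineDerivAt_cubeLaplace [DecidableEq Γ] {ψ : (Γ → ℝ) → ℂ}
    (h : IsBddOnCube ψ) (γ : Γ) (z : Γ → ℂ) :
    HasLineDerivAt ℂ (cubeLaplace ψ) (cubeLaplace (fun x => ψ x * (x γ : ℂ)) z) z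
      (Pi.single γ 1) := by
  obtain ⟨h1, h2⟩ := h.hasFDerivAt_cubeLaplace z
  have key : (∫ x in Set.Icc (0 : Γ → ℝ) 1, (ψ x * Complex.exp (linForm x z)) • linFormCLM x)
      (Pi.single γ 1) = cubeLaplace (fun x => ψ x * (x γ : ℂ)) z := by
    rw [ContinuousLinearMap.integral_apply h1]
    refine integral_congr_ae (Eventually.of_forall fun x => ?_)
    have : linForm x (Pi.single γ 1) = (x γ : ℂ) := by
      rw [linForm, sum_eq_single γ]
      · simp
      · intro b _ hb; simp [hb]
      · simp
    simp only [smul_apply, linFormCLM_apply, smul_eq_mul, this]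
    ring
  rw [← key]
  exact h2.hasLineDerivAt _

theorem IsBddOnCube.differentiable_cubeLaplace {ψ : (Γ → ℝ) → ℂ} (h : IsBddOnCube ψ) :
    Differentiable ℂ (cubeLaplace ψ) :=
  fun z => (h.hasFDerivAt_cubeLaplace z).2.differentiableAt

theorem cubeLaplace_congr {ψ φ : (Γ → ℝ) → ℂ} (h : φ =ᵐ[volume.restrict (Set.Icc 0 1)] ψ) :
    cubeLaplace φ = cubeLaplace ψ := by
  funext z
  refine integral_congr_ae ?_
  filter_upwards [h] with x hx
  rw [hx]

/-- After Γ is enumerated, the separating affine functions are the coordinates themselves. -/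
theorem cubeLaplace_stepFun_mem {σ : (Γ → ℝ) → ℚ} (hσ : σ ∈ stepFun u Γ) :
    cubeLaplace (fun x => (σ x : ℂ)) ∈ genericExpFrac u Γ (Fintype.card Γ) 0 := by
  set e := (Fintype.equivFin Γ).symm
  set E := MeasurableEquiv.piCongrLeft (fun _ : Γ => ℝ) e
  have hE (x : Fin (Fintype.card Γ) → ℝ) (γ : Γ) : E x γ = x (e.symm γ) := by
    obtain ⟨i, rfl⟩ := e.surjective γ
    simp [E, MeasurableEquiv.piCongrLeft, Equiv.piCongrLeft_apply_apply]
  have hmp : MeasurePreserving E := volume_measurePreserving_piCongrLeft (fun _ : Γ => ℝ) e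
  have haff {f : (Γ → ℝ) → ℝ} (hf : f ∈ affineFun u Γ) :
      (fun x => f (E x)) ∈ affineFun u (Fin (Fintype.card Γ)) := by
    obtain ⟨q, c, hc, hf⟩ := hf
    refine ⟨fun i => q (e i), c, hc, fun x => ?_⟩
    simp only [hf, hE]
    rw [← e.sum_comp]
    simp
  have hstep : (fun x => σ (E x)) ∈ stepFun u (Fin (Fintype.card Γ)) := by
    refine Algebra.adjoin_induction (p := fun σ _ =>
      (fun x => σ (E x)) ∈ stepFun u (Fin (Fintype.card Γ))) ?_ ?_ ?_ ?_ hσ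
    · rintro _ ⟨f, hf, rfl⟩
      exact nonnegIndicator_mem_stepFun (haff hf)
    · intro r
      exact (stepFun u _).algebraMap_mem r
    · intro f g _ _ hf hg
      exact (stepFun u _).add_mem hf hg
    · intro f g _ _ hf hg
      exact (stepFun u _).mul_mem hf hg
  have h := integral_stepFun_mul_exp_mem _ hstep (lam := fun γ x => E x γ)
    (fun γ => haff (coord_mem_affineFun γ)) (fun x y hxy => E.injective hxy)
  convert h using 1
  funext z
  rw [cubeLaplace, ← hmp.setIntegral_preimage_emb E.measurableEmbedding]
  have hpre : E ⁻¹' Set.Icc 0 1 = Set.Icc 0 1 := by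
    ext x
    simp only [Set.mem_preimage, Set.mem_Icc, Pi.le_def, hE, Pi.zero_apply, Pi.one_apply]
    rw [e.symm.forall_congr_left (p := fun γ => 0 ≤ x (e.symm γ)),
      e.symm.forall_congr_left (p := fun γ => x (e.symm γ) ≤ 1)]
    simp
  rw [hpre]

/-- The bounded functions `φ` on the unit cube whose products with step functions have Laplace
transforms of degree at most `d`. -/
def laplaceDegreeLE (u : J → ℝ) (Γ : Type*) [Fintype Γ] (d : ℕ) :
    Submodule (polyRing u) ((Γ → ℝ) → ℝ) where
  carrier := {φ | IsBddOnCube (fun x => (φ x : ℂ)) ∧ ∀ σ ∈ stepFun u Γ,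
    cubeLaplace (fun x => (σ x : ℂ) * φ x) ∈ genericExpFrac u Γ (Fintype.card Γ) d}
  zero_mem' := by
    refine ⟨IsBddOnCube.of_continuous (by simpa using continuous_const), fun σ _ => ?_⟩
    have : cubeLaplace (fun x : Γ → ℝ => (σ x : ℂ) * ((0 : (Γ → ℝ) → ℝ) x : ℂ)) = 0 := by
      funext z; simp [cubeLaplace]
    rw [this]
    exact Submodule.zero_mem _
  add_mem' := by
    rintro φ ψ ⟨h1, h2⟩ ⟨h1', h2'⟩
    refine ⟨by simpa using h1.add h1', fun σ hσ => ?_⟩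
    have : cubeLaplace (fun x => (σ x : ℂ) * ((φ + ψ) x : ℝ)) =
        cubeLaplace (fun x => (σ x : ℂ) * φ x) + cubeLaplace (fun x => (σ x : ℂ) * ψ x) := by
      funext z
      have hs := IsBddOnCube.of_stepFun hσ
      rw [Pi.add_apply, cubeLaplace, cubeLaplace, cubeLaplace,
        ← integral_add ((hs.mul h1).integrable_mul_exp z) ((hs.mul h1').integrable_mul_exp z)]
      congr 1
      funext x
      simp only [Pi.add_apply, Complex.ofReal_add]
      ring
    rw [this]
    exact Submodule.add_mem _ (h2 σ hσ) (h2' σ hσ)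
  smul_mem' := by
    rintro p φ ⟨h1, h2⟩
    have hp : (fun x => ((p • φ) x : ℂ)) = fun x => ((p : ℝ) : ℂ) * (φ x : ℂ) := by
      funext x
      rw [Pi.smul_apply, Subalgebra.smul_def, smul_eq_mul, Complex.ofReal_mul]
    refine ⟨?_, fun σ hσ => ?_⟩
    · rw [hp]; exact (IsBddOnCube.of_continuous continuous_const).mul h1
    · have : cubeLaplace (fun x => (σ x : ℂ) * ((p • φ) x : ℝ)) =
          p • cubeLaplace (fun x => (σ x : ℂ) * φ x) := by
        funext z
        rw [polyRing_smul_apply, cubeLaplace, cubeLaplace, ← integral_const_mul]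
        congr 1
        funext x
        rw [congrFun hp x]; ring
      rw [this]
      exact Submodule.smul_mem _ p (h2 σ hσ)

theorem laplaceDegreeLE_mono {d d' : ℕ} (h : d ≤ d') :
    laplaceDegreeLE u Γ d ≤ laplaceDegreeLE u Γ d' :=
  fun _ ⟨h1, h2⟩ => ⟨h1, fun σ hσ => genericExpFrac_mono h _ (h2 σ hσ)⟩

theorem laplaceDegreeLE_congr {d : ℕ} {φ ψ : (Γ → ℝ) → ℝ} (hφ : φ ∈ laplaceDegreeLE u Γ d)
    (h : ψ =ᵐ[volume.restrict (Set.Icc 0 1)] φ) : ψ ∈ laplaceDegreeLE u Γ d := by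
  obtain ⟨h1, h2⟩ := hφ
  refine ⟨h1.congr (by filter_upwards [h] with x hx; rw [hx]), fun σ hσ => ?_⟩
  rw [cubeLaplace_congr (ψ := fun x => (σ x : ℂ) * φ x)
    (by filter_upwards [h] with x hx; rw [hx])]
  exact h2 σ hσ

theorem one_mem_laplaceDegreeLE : (fun _ => 1) ∈ laplaceDegreeLE u Γ 0 :=
  ⟨IsBddOnCube.of_continuous (by simpa using continuous_const), fun σ hσ => by
    simpa using cubeLaplace_stepFun_mem hσ⟩

/-- No degree is lost because `laplaceDegreeLE` tests against all step functions, and these form an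
algebra. -/
theorem stepFun_mul_mem_laplaceDegreeLE {d : ℕ} {φ : (Γ → ℝ) → ℝ}
    (hφ : φ ∈ laplaceDegreeLE u Γ d) {τ : (Γ → ℝ) → ℚ} (hτ : τ ∈ stepFun u Γ) :
    (fun x => (τ x : ℝ) * φ x) ∈ laplaceDegreeLE u Γ d := by
  obtain ⟨h1, h2⟩ := hφ
  refine ⟨by simpa using (IsBddOnCube.of_stepFun hτ).mul h1, fun σ hσ => ?_⟩
  have := h2 _ ((stepFun u Γ).mul_mem hσ hτ)
  convert this using 3 with x
  simp [mul_assoc]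

/-- A factor x_γ under the integral is the derivative in z_γ, which raises the degree by one. -/
theorem coord_mul_mem_laplaceDegreeLE {d : ℕ} {φ : (Γ → ℝ) → ℝ}
    (hφ : φ ∈ laplaceDegreeLE u Γ d) (γ : Γ) :
    (fun x => x γ * φ x) ∈ laplaceDegreeLE u Γ (d + 1) := by
  classical
  obtain ⟨h1, h2⟩ := hφ
  refine ⟨?_, fun σ hσ => ?_⟩
  · simp only [Complex.ofReal_mul]
    exact (IsBddOnCube.of_continuous (by fun_prop)).mul h1
  · have := mem_genericExpFrac_of_hasLineDerivAt (h2 σ hσ)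
      (fun z => ((IsBddOnCube.of_stepFun hσ).mul h1).hasLineDerivAt_cubeLaplace γ z)
    convert this using 3 with x
    push_cast; ring

theorem affineFun_mul_mem_laplaceDegreeLE {d : ℕ} {φ : (Γ → ℝ) → ℝ}
    (hφ : φ ∈ laplaceDegreeLE u Γ d) {f : (Γ → ℝ) → ℝ} (hf : f ∈ affineFun u Γ) :
    (fun x => f x * φ x) ∈ laplaceDegreeLE u Γ (d + 1) := by
  obtain ⟨q, c, hc, hf⟩ := hf
  have h1 : ∑ γ, (⟨(q γ : ℝ), ratCast_mem_polyRing (q γ)⟩ : polyRing u) •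
      (fun x : Γ → ℝ => x γ * φ x) ∈ laplaceDegreeLE u Γ (d + 1) :=
    Submodule.sum_mem _ fun γ _ => Submodule.smul_mem _ _ (coord_mul_mem_laplaceDegreeLE hφ γ)
  have h2 := (laplaceDegreeLE u Γ (d + 1)).smul_mem ⟨c, coeffSpace_le_polyRing hc⟩
    (laplaceDegreeLE_mono d.le_succ hφ)
  convert Submodule.add_mem _ h1 h2 using 1
  funext x
  simp only [hf, Pi.add_apply, Finset.sum_apply, Pi.smul_apply, Subalgebra.smul_def, smul_eq_mul,
    add_mul, sum_mul, mul_assoc]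

theorem affineFun_pow_mul_mem_laplaceDegreeLE {d : ℕ} {φ : (Γ → ℝ) → ℝ}
    (hφ : φ ∈ laplaceDegreeLE u Γ d) {f : (Γ → ℝ) → ℝ} (hf : f ∈ affineFun u Γ) (k : ℕ) :
    (fun x => f x ^ k * φ x) ∈ laplaceDegreeLE u Γ (d + k) := by
  induction k with
  | zero => simpa using hφ
  | succ k ih =>
    have := affineFun_mul_mem_laplaceDegreeLE ih hf
    simp only [pow_succ', mul_assoc]
    exact this

theorem aeval_affineFun_mul_mem_laplaceDegreeLE {d : ℕ} {φ : (Γ → ℝ) → ℝ}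
    (hφ : φ ∈ laplaceDegreeLE u Γ d) {f : (Γ → ℝ) → ℝ} (hf : f ∈ affineFun u Γ)
    {k : ℕ} (p : Polynomial ℚ) (hp : p.natDegree ≤ k) :
    (fun x => Polynomial.aeval (f x) p * φ x) ∈ laplaceDegreeLE u Γ (d + k) := by
  have h1 : ∑ i ∈ range (k + 1), (⟨(p.coeff i : ℝ), ratCast_mem_polyRing _⟩ : polyRing u) •
      (fun x : Γ → ℝ => f x ^ i * φ x) ∈ laplaceDegreeLE u Γ (d + k) :=
    Submodule.sum_mem _ fun i hi => Submodule.smul_mem _ _ (laplaceDegreeLE_mono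
      (by have := mem_range.1 hi; omega) (affineFun_pow_mul_mem_laplaceDegreeLE hφ hf i))
  convert h1 using 1
  funext x
  rw [Polynomial.aeval_eq_sum_range' (Nat.lt_succ_of_le hp)]
  simp only [Finset.sum_apply, Pi.smul_apply, Subalgebra.smul_def, smul_eq_mul, Rat.smul_def,
    sum_mul, mul_assoc]

theorem natDegree_bernoulli_le (k : ℕ) : (Polynomial.bernoulli k).natDegree ≤ k :=
  Polynomial.natDegree_sum_le_of_forall_le _ _ fun _ _ =>
    (Polynomial.natDegree_monomial_le _).trans (Nat.sub_le _ _)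

/-- The difference of indicators is that of n ≤ t < n + 1, so only n = ⌊t⌋ contributes, and |t| < M
keeps this n in range. -/
theorem bernoulliFun_fract_eq_sum (k : ℕ) {M : ℕ} {t : ℝ} (ht : |t| < M) :
    bernoulliFun k (Int.fract t) = ∑ n ∈ Icc (-(M : ℤ)) M,
      (((if 0 ≤ t - n then 1 else 0) - (if 0 ≤ t - (n + 1) then 1 else 0) : ℚ) : ℝ) *
        bernoulliFun k (t - n) := by
  have hfl : ⌊t⌋ ∈ Icc (-(M : ℤ)) M := by
    rw [abs_lt] at ht
    rw [mem_Icc]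
    constructor
    · rw [Int.le_floor]; push_cast; exact ht.1.le
    · rw [Int.floor_le_iff]; push_cast; linarith
  rw [sum_eq_single_of_mem ⌊t⌋ hfl]
  · have h1 : 0 ≤ t - ⌊t⌋ := by linarith [Int.floor_le t]
    have h2 : ¬ 0 ≤ t - (⌊t⌋ + 1) := by linarith [Int.lt_floor_add_one t]
    rw [if_pos h1, if_neg h2, Int.self_sub_floor]
    simp
  · intro n _ hn
    rcases lt_or_gt_of_ne hn with h | h
    · have h3 : ((n + 1 : ℤ) : ℝ) ≤ t := Int.le_floor.1 h
      push_cast at h3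
      rw [if_pos (by linarith), if_pos (by linarith)]; simp
    · have h3 : t < n := Int.floor_lt.1 h
      rw [if_neg (by linarith), if_neg (by linarith)]; simp

theorem bernoulliFun_fract_mul_mem_laplaceDegreeLE {d : ℕ} {φ : (Γ → ℝ) → ℝ}
    (hφ : φ ∈ laplaceDegreeLE u Γ d) {f : (Γ → ℝ) → ℝ} (hf : f ∈ affineFun u Γ) (k : ℕ) :
    (fun x => bernoulliFun k (Int.fract (f x)) * φ x) ∈ laplaceDegreeLE u Γ (d + k) := by
  -- f is bounded on the cube, so finitely many slabs n ≤ f < n + 1 suffice.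
  obtain ⟨C, hC⟩ := isCompact_Icc.exists_bound_of_continuousOn
    ((continuous_of_mem_affineFun hf).continuousOn (s := Set.Icc (0 : Γ → ℝ) 1))
  obtain ⟨M, hM⟩ := exists_nat_gt C
  have hsub (n : ℤ) : (fun x => f x - n) ∈ affineFun u Γ :=
    (affineFun u Γ).sub_mem hf
      (const_mem_affineFun (by simpa using ratCast_mem_coeffSpace (u := u) (n : ℚ)))
  have h1 : ∑ n ∈ Icc (-(M : ℤ)) M, (fun x => (((nonnegIndicator (fun x => f x - n) -
      nonnegIndicator (fun x => f x - (n + 1 : ℤ))) x : ℚ) : ℝ) *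
        (Polynomial.aeval (f x - n) (Polynomial.bernoulli k) * φ x)) ∈
      laplaceDegreeLE u Γ (d + k) :=
    Submodule.sum_mem _ fun n _ => stepFun_mul_mem_laplaceDegreeLE
      (aeval_affineFun_mul_mem_laplaceDegreeLE hφ (hsub n) _ (natDegree_bernoulli_le k))
      ((stepFun u Γ).sub_mem (nonnegIndicator_mem_stepFun (hsub n))
        (nonnegIndicator_mem_stepFun (hsub (n + 1))))
  refine laplaceDegreeLE_congr h1 (ae_restrict_of_forall_mem measurableSet_Icc fun x hx => ?_)
  change bernoulliFun k (Int.fract (f x)) * φ x = _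
  rw [bernoulliFun_fract_eq_sum k ((hC x hx).trans_lt hM)]
  simp only [Finset.sum_apply, sum_mul, nonnegIndicator, Pi.sub_apply, mul_assoc, bernoulliFun, Polynomial.eval_map_algebraMap]
  push_cast
  rfl

theorem prod_bernoulliFun_fract_mem_laplaceDegreeLE {ι : Type*} (s : Finset ι)
    {f : ι → (Γ → ℝ) → ℝ} (hf : ∀ i, f i ∈ affineFun u Γ) (k : ι → ℕ) :
    (fun x => ∏ i ∈ s, bernoulliFun (k i) (Int.fract (f i x))) ∈
      laplaceDegreeLE u Γ (∑ i ∈ s, k i) := by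
  classical
  induction s using Finset.induction_on with
  | empty => simpa using one_mem_laplaceDegreeLE
  | insert i s hi ih =>
    simp only [prod_insert hi, sum_insert hi]
    rw [add_comm]
    exact bernoulliFun_fract_mul_mem_laplaceDegreeLE ih (hf i) (k i)

end PiecewisePolynomial

/-! ### The function `f^♯` as a Laplace transform -/

section FSharpLaplace

open Filter Topology Finset MeasureTheory

variable {V J : Type*} [NormedAddCommGroup V] [InnerProductSpace ℝ V] [Fintype J]

/-- The open interval matters only for k = 1: at x = 0 the symmetric sum is 0, whereas B_1(0) =
-1/2. The discrepancy lies on the boundary of the cube, a null set. -/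
theorem lerchL_eq_of_mem_Ioo {k : ℕ} (hk : 1 ≤ k) {x : ℝ} (hx : x ∈ Set.Ioo (0 : ℝ) 1) (c : ℤ) :
    lerchL k x c = bernoulliFun k (Int.fract x) := by
  rcases hk.eq_or_lt with rfl | h
  · rw [lerchL_one_eq hx.1 hx.2, Int.fract_eq_self.2 ⟨hx.1.le, hx.2⟩]
  · exact lerchL_eq_bernoulliFun_fract h x c

theorem ae_restrict_Icc_mem_Ioo {Γ : Type*} [Fintype Γ] :
    ∀ᵐ x ∂volume.restrict (Set.Icc (0 : Γ → ℝ) 1), ∀ γ, x γ ∈ Set.Ioo (0 : ℝ) 1 := by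
  have h : (Set.univ.pi fun γ : Γ => Set.Ioo ((0 : Γ → ℝ) γ) ((1 : Γ → ℝ) γ)) =ᵐ[volume]
      Set.Icc (0 : Γ → ℝ) 1 := Measure.univ_pi_Ioo_ae_eq_Icc
  rw [← Measure.restrict_congr_set h]
  filter_upwards [ae_restrict_mem (MeasurableSet.univ_pi fun _ => measurableSet_Ioo)] with x hx γ
  exact hx γ (Set.mem_univ γ)

/-- Splits off the power of πi and leaves a rational constant, which the ℚ[y]-coefficients absorb.
-/
theorem prod_two_pi_I_cpow_div_Gamma {α : Type*} (D : Finset α) (k : α → ℕ) :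
    ∏ γ ∈ D, (2 * Real.pi * Complex.I) ^ (k γ : ℂ) / Complex.Gamma (k γ + 1) =
      (Real.pi * Complex.I) ^ (∑ γ ∈ D, k γ) *
        ((∏ γ ∈ D, (2 : ℚ) ^ k γ / (k γ).factorial : ℚ) : ℂ) := by
  push_cast
  rw [← prod_pow_eq_pow_sum, ← prod_mul_distrib]
  refine prod_congr rfl fun γ _ => ?_
  rw [Complex.cpow_natCast, Complex.Gamma_nat_eq_factorial, mul_assoc, mul_pow]
  ring

omit [NormedAddCommGroup V] [InnerProductSpace ℝ V] in
theorem nonBasis_subset (D : Finset (V × ℝ)) (B : J → V × ℝ) : nonBasis D B ⊆ D := by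
  intro γ hγ
  simp only [nonBasis, mem_filter] at hγ
  exact hγ.1

omit [NormedAddCommGroup V] [InnerProductSpace ℝ V] in
theorem sum_nonBasis_add_sum (D : Finset (V × ℝ)) {B : J → V × ℝ} (hB : Function.Injective B)
    (hBD : ∀ j, B j ∈ D) (k : V × ℝ → ℕ) :
    ∑ γ : nonBasis D B, k γ + ∑ j, k (B j) = ∑ γ ∈ D, k γ := by
  classical
  have h1 : ∑ γ : nonBasis D B, k γ = ∑ γ ∈ nonBasis D B, k γ := sum_coe_sort _ _
  have h2 : ∑ j, k (B j) = ∑ γ ∈ univ.image B, k γ := (sum_image hB.injOn).symm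
  have h3 : univ.image B = D.filter fun γ => ¬ γ ∉ Set.range B := by
    ext γ
    simp only [mem_image, mem_univ, true_and, mem_filter, Set.mem_range, not_not]
    exact ⟨fun ⟨j, hj⟩ => ⟨hj ▸ hBD j, j, hj⟩, fun h => h.2⟩
  rw [h1, h2, h3, nonBasis]
  have h4 := sum_filter_add_sum_filter_not D (fun γ => ¬ ∃ j, B j = γ) k
  simp only [Set.mem_range]
  convert h4

/-- Up to elementary factors, `fSharpExt` is the Laplace transform of a product of periodic
Bernoulli polynomials. -/
theorem exists_fSharpExt_eq_cubeLaplace (D : Finset (V × ℝ)) {B : J → V × ℝ}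
    (hB : Function.Injective B) (hBD : ∀ j, B j ∈ D) (μ : J → V) (k : V × ℝ → ℕ)
    (hkB : ∀ j, 2 ≤ k (B j)) (hkD : ∀ γ ∈ D, 1 ≤ k γ) (y : V)
    (hc : ∀ γ ∈ D, ∃ c : ℤ, γ.2 = c) (hint : ∀ γ ∈ D, ∀ j, ∃ n : ℤ, ⟪γ.1, μ j⟫ = n) :
    ∃ φ ∈ laplaceDegreeLE (fun j => ⟪y, μ j⟫) (nonBasis D B) (∑ γ ∈ D, k γ),
      ∀ z, fSharpExt D B μ (fun γ => (k γ : ℂ)) y z =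
        Complex.exp (-(2 * Real.pi * Complex.I * (⟪y, nuVec B μ⟫ : ℝ))) *
          (Real.pi * Complex.I) ^ (∑ γ ∈ D, k γ) *
          (((-1) ^ D.card * ∏ γ ∈ D, (2 : ℚ) ^ k γ / (k γ).factorial : ℚ) : ℂ) *
          cubeLaplace (fun x => (φ x : ℂ)) (fun γ => -(2 * Real.pi * Complex.I) * z γ) := by
  set u : J → ℝ := fun j => ⟪y, μ j⟫
  have hmem (γ : nonBasis D B) : γ.1 ∈ D := nonBasis_subset D B γ.2
  choose n hn using fun γ : nonBasis D B => hint γ.1 (hmem γ)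
  -- All Bernoulli factors are treated uniformly; the exponents over this index set add up to the
  -- sum of k over D.
  let f : nonBasis D B ⊕ J → (nonBasis D B → ℝ) → ℝ :=
    Sum.elim (fun γ x => x γ) (fun j x => u j - ∑ γ, x γ * ⟪γ.1.1, μ j⟫)
  have hf (i) : f i ∈ affineFun u (nonBasis D B) := by
    rcases i with γ | j
    · exact coord_mem_affineFun γ
    · refine ⟨fun γ => -(n γ j : ℚ), u j,
        Submodule.subset_span (Set.mem_insert_of_mem _ ⟨j, rfl⟩), fun x => ?_⟩
      simp only [f, Sum.elim_inr, hn]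
      push_cast
      rw [sub_eq_neg_add, ← sum_neg_distrib]
      congr 1
      exact sum_congr rfl fun γ _ => by ring
  have hφ := prod_bernoulliFun_fract_mem_laplaceDegreeLE univ hf
    (Sum.elim (fun γ => k γ.1) fun j => k (B j))
  rw [Fintype.sum_sum_type] at hφ
  simp only [Sum.elim_inl, Sum.elim_inr] at hφ
  rw [sum_nonBasis_add_sum D hB hBD k] at hφ
  refine ⟨_, hφ, fun z => ?_⟩
  have hI : ∫ x in Set.Icc (0 : nonBasis D B → ℝ) 1,
      Complex.exp (-(2 * Real.pi * Complex.I * ∑ γ : nonBasis D B, z γ * (x γ : ℂ))) *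
      (∏ γ : nonBasis D B, lerchL (k γ.1) (x γ) γ.1.2) *
      ∏ j, lerchL (k (B j)) (⟪y, μ j⟫ - ∑ γ : nonBasis D B, x γ * ⟪γ.1.1, μ j⟫) (B j).2 =
      cubeLaplace (fun x => ((∏ i, bernoulliFun ((Sum.elim (fun γ => k γ.1) fun j => k (B j) :
        nonBasis D B ⊕ J → ℕ) i) (Int.fract (f i x)) : ℝ) : ℂ))
        (fun γ => -(2 * Real.pi * Complex.I) * z γ) := by
    refine integral_congr_ae ?_
    filter_upwards [ae_restrict_Icc_mem_Ioo] with x hx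
    have h1 : ∏ γ : nonBasis D B, lerchL (k γ.1) (x γ) γ.1.2 =
        ∏ γ : nonBasis D B, (bernoulliFun (k γ.1) (Int.fract (x γ)) : ℂ) := by
      refine prod_congr rfl fun γ _ => ?_
      obtain ⟨c, hc⟩ := hc γ.1 (hmem γ)
      rw [hc]
      exact lerchL_eq_of_mem_Ioo (hkD γ.1 (hmem γ)) (hx γ) c
    have h2 : ∏ j, lerchL (k (B j)) (⟪y, μ j⟫ - ∑ γ : nonBasis D B, x γ * ⟪γ.1.1, μ j⟫) (B j).2 =
        ∏ j, (bernoulliFun (k (B j)) (Int.fract (f (Sum.inr j) x)) : ℂ) := by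
      refine prod_congr rfl fun j _ => ?_
      obtain ⟨c, hc⟩ := hc (B j) (hBD j)
      rw [hc]
      exact lerchL_eq_bernoulliFun_fract (hkB j) _ c
    have h3 : -(2 * Real.pi * Complex.I * ∑ γ : nonBasis D B, z γ * (x γ : ℂ)) =
        linForm x (fun γ => -(2 * Real.pi * Complex.I) * z γ) := by
      rw [linForm_mul_left, linForm, neg_mul]
      simp only [mul_comm]
    rw [h1, h2, h3, Fintype.prod_sum_type]
    simp only [Sum.elim_inl, Sum.elim_inr, Complex.ofReal_mul, Complex.ofReal_prod, f]
    ring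
  rw [fSharpExt, hI, prod_two_pi_I_cpow_div_Gamma]
  push_cast
  ring

theorem fSharp_eq_fSharpExt (D : Finset (V × ℝ)) (B : J → V × ℝ) (μ : J → V) (s : V × ℝ → ℂ)
    (y lam : V) : fSharp D B μ s y lam =
      fSharpExt D B μ s y fun γ => (affineEval γ.1 (lam - nuVec B μ) : ℂ) := by
  simp only [fSharp, fSharpExt, Complex.ofReal_sum, Complex.ofReal_mul]

theorem differentiable_fSharpExt (D : Finset (V × ℝ)) {B : J → V × ℝ}
    (hB : Function.Injective B) (hBD : ∀ j, B j ∈ D) (μ : J → V) (k : V × ℝ → ℕ)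
    (hkB : ∀ j, 2 ≤ k (B j)) (hkD : ∀ γ ∈ D, 1 ≤ k γ) (y : V)
    (hc : ∀ γ ∈ D, ∃ c : ℤ, γ.2 = c) (hint : ∀ γ ∈ D, ∀ j, ∃ n : ℤ, ⟪γ.1, μ j⟫ = n) :
    Differentiable ℂ (fSharpExt D B μ (fun γ => (k γ : ℂ)) y) := by
  obtain ⟨φ, hφ, h⟩ := exists_fSharpExt_eq_cubeLaplace D hB hBD μ k hkB hkD y hc hint
  rw [funext h]
  exact (hφ.1.differentiable_cubeLaplace.comp (by fun_prop)).const_mul _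

/-- The Laplace transform is taken with step function 1 and its generic representative is split by
κ. Each piece is rewritten at -2πi z, at the cost of (πi)^(κ+N), which turns (πi)^|k| into the
stated power. -/
theorem exists_fSharpExt_eq_sum (D : Finset (V × ℝ)) {B : J → V × ℝ}
    (hB : Function.Injective B) (hBD : ∀ j, B j ∈ D) (μ : J → V) (k : V × ℝ → ℕ)
    (hkB : ∀ j, 2 ≤ k (B j)) (hkD : ∀ γ ∈ D, 1 ≤ k γ) (y : V)
    (hc : ∀ γ ∈ D, ∃ c : ℤ, γ.2 = c) (hint : ∀ γ ∈ D, ∀ j, ∃ n : ℤ, ⟪γ.1, μ j⟫ = n) :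
    ∃ (m : ℕ → ℕ) (F G : (κ : ℕ) → Fin (m κ) → (nonBasis D B → ℂ) → ℂ),
      (∀ κ e, IsNumerator (fun j => ⟪y, μ j⟫) (F κ e)) ∧
      (∀ κ e, IsDenominator (fun j => ⟪y, μ j⟫) (κ + (nonBasis D B).card) (G κ e)) ∧
      ∀ z, (∀ κ ∈ range (∑ γ ∈ D, k γ + 1), ∀ e, G κ e z ≠ 0) →
        fSharpExt D B μ (fun γ => (k γ : ℂ)) y z =
          Complex.exp (-(2 * Real.pi * Complex.I * (⟪y, nuVec B μ⟫ : ℝ))) *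
            ∑ κ ∈ range (∑ γ ∈ D, k γ + 1),
              (Real.pi * Complex.I) ^
                  (((∑ γ ∈ D, k γ : ℕ) : ℤ) - ((κ + (nonBasis D B).card : ℕ) : ℤ)) *
                ∑ e, F κ e z / G κ e z := by
  obtain ⟨φ, hφ, h⟩ := exists_fSharpExt_eq_cubeLaplace D hB hBD μ k hkB hkD y hc hint
  have h1 := hφ.2 1 (stepFun _ _).one_mem
  simp only [Pi.one_apply, Rat.cast_one, one_mul] at h1
  obtain ⟨Q, hQ⟩ : ∃ Q : ℚ, Q = (-1) ^ D.card * ∏ γ ∈ D, (2 : ℚ) ^ k γ / (k γ).factorial :=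
    ⟨_, rfl⟩
  rw [← hQ] at h
  obtain ⟨G, hG, H⟩ := ratCast_smul_mem_genericExpFrac Q h1
  rw [Fintype.card_coe] at hG
  obtain ⟨W, hW, hWH⟩ := exists_forms_of_eventually H
  obtain ⟨F, rfl⟩ := (Submodule.mem_iSup_finset_iff_exists_sum _ _).1 hG
  choose m f g hf hg hfg hgW using fun κ => exists_numerators_denominators (F κ).2 W hW
  refine ⟨m, f, g, hf, hg, fun z hz => ?_⟩
  have hpi : (Real.pi * Complex.I : ℂ) ≠ 0 := by simp [Real.pi_ne_zero]
  have hne : ∀ w ∈ W, linForm w (fun γ => -(2 * Real.pi * Complex.I) * z γ) ≠ 0 := by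
    intro w hw
    rw [linForm_mul_left]
    refine mul_ne_zero (neg_ne_zero.2 Complex.two_pi_I_ne_zero) ?_
    -- Without variables there is no nonzero form, so W is empty. Otherwise the denominators for κ =
    -- 0 have at least one factor and already exclude the hyperplanes of W.
    rcases eq_or_ne (nonBasis D B).card 0 with h0 | h0
    · have : IsEmpty (nonBasis D B) := by
        rw [Finset.card_eq_zero.1 h0]; infer_instance
      exact absurd (Subsingleton.elim w 0) (hW w hw).1
    · exact hgW 0 (by simpa using h0) z (hz 0 (by simp)) w hw
  have hsum := hWH _ hne
  simp only [Finset.sum_apply] at hsum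
  rw [h, mul_assoc, mul_assoc, hsum, mul_sum]
  congr 1
  refine sum_congr rfl fun κ _ => ?_
  rw [← hfg, zpow_sub₀ hpi, zpow_natCast, zpow_natCast]
  have := pow_ne_zero (κ + (nonBasis D B).card) hpi
  field_simp

end FSharpLaplace

/-! ### Integrality of the pairing between coroots and weights -/

section Integrality

variable {ι V : Type*} [NormedAddCommGroup V] [InnerProductSpace ℝ V]
  {P : RootPairing ι ℝ V V} [P.IsRootSystem]

/-- Extends ⟨α_i^∨, λ_j⟩ = δ_{ij} bilinearly. It is what makes the affine arguments of the Bernoulli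
factors rational in their linear part. -/
theorem exists_inner_eq_intCast [DecidableEq ι] (hP : P.toLinearMap = innerₗ V) (b : P.Base)
    {J K : Finset b.support} {v w : V} (hv : v ∈ corootLattice b J) (hw : w ∈ weightLattice b K) :
    ∃ n : ℤ, ⟪v, w⟫ = n := by
  refine Submodule.span_induction (p := fun v _ => ∃ n : ℤ, ⟪v, w⟫ = n) ?_ ⟨0, by simp⟩ ?_ ?_ hv
  · rintro _ ⟨i, -, rfl⟩
    refine Submodule.span_induction (p := fun w _ => ∃ n : ℤ, ⟪P.coroot i, w⟫ = n) ?_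
      ⟨0, by simp⟩ ?_ ?_ hw
    · rintro _ ⟨j, -, rfl⟩
      have := fundamentalWeight_coroot b i j
      rw [hP, innerₗ_apply_apply, real_inner_comm] at this
      exact ⟨if i = j then 1 else 0, by rw [this]; split_ifs <;> simp⟩
    · rintro x y _ _ ⟨m, hm⟩ ⟨n, hn⟩
      exact ⟨m + n, by rw [inner_add_right, hm, hn]; push_cast; rfl⟩
    · rintro a x _ ⟨m, hm⟩
      refine ⟨a * m, ?_⟩
      rw [← Int.cast_smul_eq_zsmul ℝ, inner_smul_right, hm]; push_cast; rfl
  · rintro x y _ _ ⟨m, hm⟩ ⟨n, hn⟩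
    exact ⟨m + n, by rw [inner_add_left, hm, hn]; push_cast; rfl⟩
  · rintro a x _ ⟨m, hm⟩
    refine ⟨a * m, ?_⟩
    rw [← Int.cast_smul_eq_zsmul ℝ, real_inner_smul_left, hm]; push_cast; rfl

end Integrality

end FuncRel

end

theorem mainTheorem8
    {ι V : Type*} [Finite ι] [DecidableEq ι]
    [NormedAddCommGroup V] [InnerProductSpace ℝ V] [FiniteDimensional ℝ V]
    -- a finite reduced root system in `V`; the dual of `V` is identified with `V`
    (P : RootPairing ι ℝ V V) (hP : P.toLinearMap = innerₗ V)
    [P.IsRootSystem] [P.IsReduced] [P.IsCrystallographic]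
    -- a fundamental system, and a subset `I` of it
    (b : P.Base) (I : Finset b.support)
    -- the finite set `D = D_{I^c}`
    (D : Finset (V × ℝ))
    (hD : ∀ γ ∈ D, γ.1 ∈ FuncRel.corootLattice b Finset.univ ∧ γ.1 ≠ 0)
    -- the subset `B = {η_i + c_i δ}_{i ∈ I^c}`, with `η` a basis of `Q^∨_{I^c}`
    (η : Module.Basis ↥(Iᶜ) ℤ (FuncRel.corootLattice b Iᶜ)) (c : ↥(Iᶜ) → ℝ)
    (B : ↥(Iᶜ) → V × ℝ) (hB : ∀ i, B i = ((η i : V), c i)) (hBD : ∀ i, B i ∈ D)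
    -- the basis `μ` of `P_{I^c}` dual to `η`
    (μ : ↥(Iᶜ) → V) (hμ : ∀ i, μ i ∈ FuncRel.weightLattice b Iᶜ)
    (hdual : ∀ i j, inner ℝ (η i : V) (μ j) = if i = j then (1 : ℝ) else 0)
    -- the parameter `y`
    (y : V) (hy : y ∈ FuncRel.rootSubspace b Iᶜ)
    -- integrality
    (hDint : ∀ γ ∈ D, γ ∈ FuncRel.affineCorootLattice b)
    (k : V × ℝ → ℕ) (hkB : ∀ i, 2 ≤ k (B i)) (hkD : ∀ γ ∈ D, 1 ≤ k γ) :
    ∃ (m : ℕ → ℕ)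
      (F G : (κ : ℕ) → Fin (m κ) → (FuncRel.nonBasis D B → ℂ) → ℂ),
      (∀ κ e, FuncRel.IsNumerator (fun i => inner ℝ y (μ i)) (F κ e)) ∧
      (∀ κ e, FuncRel.IsDenominator (fun i => inner ℝ y (μ i))
        (κ + (FuncRel.nonBasis D B).card) (G κ e)) ∧
      -- the displayed formula, as an identity in the variables `z_γ`; where a denominator
      -- vanishes the value is that of the entire function on the left
      (∀ z, (∀ κ ∈ Finset.range (∑ γ ∈ D, k γ + 1), ∀ e, G κ e z ≠ 0) →
        FuncRel.fSharpExt D B μ (fun γ => (k γ : ℂ)) y z =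
          Complex.exp (-(2 * Real.pi * Complex.I * (inner ℝ y (FuncRel.nuVec B μ) : ℝ))) *
            ∑ κ ∈ Finset.range (∑ γ ∈ D, k γ + 1),
              (Real.pi * Complex.I) ^
                  (((∑ γ ∈ D, k γ : ℕ) : ℤ) - ((κ + (FuncRel.nonBasis D B).card : ℕ) : ℤ)) *
                ∑ e, F κ e z / G κ e z) ∧
      Differentiable ℂ (FuncRel.fSharpExt D B μ (fun γ => (k γ : ℂ)) y) ∧
      -- `f^♯(λ)` is the value at `z_γ = γ(λ - ν)`
      ∀ lam ∈ FuncRel.weightLattice b I,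
        FuncRel.fSharp D B μ (fun γ => (k γ : ℂ)) y lam =
          FuncRel.fSharpExt D B μ (fun γ => (k γ : ℂ)) y
            (fun γ => (FuncRel.affineEval γ.1 (lam - FuncRel.nuVec B μ) : ℂ)) := by
  -- The gradients η_i are distinct basis vectors, so the k_γ over D split into those over D ∖ B and
  -- those of the family B.
  have hinj : Function.Injective B := by
    intro i j hij
    rw [hB, hB] at hij
    exact η.injective (Subtype.ext (congrArg Prod.fst hij))
  have hc : ∀ γ ∈ D, ∃ n : ℤ, γ.2 = n := by
    intro γ hγ
    obtain ⟨n, hn⟩ := Submodule.mem_span_singleton.1 (hDint γ hγ).2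
    exact ⟨n, by simp [← hn]⟩
  have hint : ∀ γ ∈ D, ∀ j, ∃ n : ℤ, inner ℝ γ.1 (μ j) = n := fun γ hγ j =>
    FuncRel.exists_inner_eq_intCast hP b (hD γ hγ).1 (hμ j)
  obtain ⟨m, F, G, hF, hG, h⟩ :=
    FuncRel.exists_fSharpExt_eq_sum D hinj hBD μ k hkB hkD y hc hint
  exact ⟨m, F, G, hF, hG, h, FuncRel.differentiable_fSharpExt D hinj hBD μ k hkB hkD y hc hint,
    fun lam _ => FuncRel.fSharp_eq_fSharpExt D B μ _ y lam⟩
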